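/- \textbf{Setting.} Types are generated from type constants by $A\to A$, $\top$, $A\times A$, $\bot$, $A\lor A$, and $\lnot A:=A\to\bot$. Typed terms $\Gamma\vdash M:A\mid\Delta$ of the call-by-name $\lambda\mu$-calculus are built from typed constants and variables, $\lambda x.M$, $MN$, $*$, $\langle M,N\rangle$, $\pi_jM$, $\mu a.M$, $aM$, $\mu(a_1,a_2).M$, $[a_1,a_2]M$, where $\Gamma$ types the variables and $\Delta$ the control variables. $M[a\Box:=C]$ denotes the recursive replacement of $aM'$ by $C[M'[a\Box:=C]]$ and of $[a_1,a_2]M'$ by $C[\mu a.[a_1,a_2]M'[a\Box:=C]]$ when $a\in\{a_1,a_2\}$. A \emph{$\lambda\mu$-theory} is a congruence $=$ on typed terms in environments, closed under enlarging and permuting environments, that contains the axioms (with the usual freshness conditions): $$\begin{gathered} (\lambda x.M)N=M[x:=N],\quad \lambda x.Mx=M,\quad \pi_j\langle M_1,M_2\rangle=M_j,\quad \langle\pi_1M,\pi_2M\rangle=M,\quad *=M,\\ b(\mu a.M)=M[a:=b],\quad \mu a.aM=M,\quad [b_1,b_2](\mu(a_1,a_2).M)=M[a_1,a_2:=b_1,b_2],\\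 \mu(a_1,a_2).[a_1,a_2]M=M,\quad bM=M\ \ (b:\bot),\\ (\mu a.M)N=\mu b.M[a\Box:=b(\Box N)],\quad \pi_j(\mu a.M)=\mu b.M[a\Box:=b(\pi_j\Box)],\quad [a_1,a_2](\mu a.M)=M[a\Box:=[a_1,a_2]\Box]. \end{gathered}$$ Fix a $\lambda\mu$-theory. A \emph{function} $B\to A$ is a closed term of type $B\to A$, considered up to $=$; composition is $g\circ f=\lambda x.g(fx)$, and $\lnot f:=\lambda k.\lambda x.k(fx):\lnot A\to\lnot B$ for $f:B\to A$. A function $f:B\to A$ is \emph{focal} if $f(\mu a.M)=\mu b.M[a\Box:=b(f\Box)]$ for every term $M$ ($b$ fresh). Identities, composites of focal functions, and all functions $\lnot f$ are focal. A \emph{functor} $G$ sends types to types and functions $B\to A$ to functions $GB\to GA$, preserves composition (preservation of identities is not needed) and sends focal functions to focal functions. A \emph{focus functor} $F$ is a composition-preserving operation of this kind that is defined on focal functions only and has focal values. A \emph{natural isomorphism} $\lnot G\alpha\cong F(\lnot\alpha)$ is a family of focal functions $\varphi_A:\lnot GA\to F(\lnot A)$ with focal two-sided inverses such that $F(\lnot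 f)\circ\varphi_A=\varphi_B\circ\lnot(Gf)$ for every function $f:B\to A$. \textbf{Theorem.} Let $F$ be a focus functor and $G$ a functor on the $\lambda\mu$-theory, with a natural isomorphism $\varphi:\lnot G\alpha\cong F(\lnot\alpha)$. Let $X:\nu G\to G(\nu G)$ be a final $G$-coalgebra, that is, for every function $f:A\to GA$ there is a unique function $h:A\to\nu G$ with $X\circ h=Gh\circ f$. Suppose that $X$ is focal. Then $$F(\lnot\nu G)\xrightarrow{\ \varphi_{\nu G}^{-1}\ }\lnot G(\nu G)\xrightarrow{\ \lnot X\ }\lnot\nu G$$ is a focally initial $F$-algebra: this composite $\Phi=\lnot X\circ\varphi_{\nu G}^{-1}$ is focal, and for every focal function $f:FA\to A$ there is a focal function $h:\lnot\nu G\to A$ with $h\circ\Phi=f\circ Fh$, and $h$ is unique among focal functions. -/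

import Mathlib

universe u v

namespace LambdaMu

/-- Types over a set `K` of type constants. -/
inductive Ty (K : Type u) : Type u
  | const (τ : K) : Ty K
  | arrow (B A : Ty K) : Ty K
  | top : Ty K
  | prod (A₁ A₂ : Ty K) : Ty K
  | bot : Ty K
  | or (A₁ A₂ : Ty K) : Ty K

/-- Negation `¬A` is `A → ⊥`. -/
abbrev Ty.not {K : Type u} (A : Ty K) : Ty K := Ty.arrow A Ty.bot

/-- A typing environment: the list of the types of the (nameless) variables. -/
abbrev Env (K : Type u) : Type u := List (Ty K)

/-- `Var Γ A`: the occurrences of the type `A` in `Γ`, that is, the variables of type `A`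
(de Bruijn indices). Used for variables and for control variables. -/
inductive Var {K : Type u} : Env K → Ty K → Type u
  | zero {Γ : Env K} {A : Ty K} : Var (A :: Γ) A
  | succ {Γ : Env K} {A B : Ty K} (x : Var Γ A) : Var (B :: Γ) A

/-- Type constants, and the constants of each type. -/
structure Signature where
  TyConst : Type u
  Const : Ty TyConst → Type v

/-- `Term S Γ Δ A`: the terms `M` with a derivation of `Γ ⊢ M : A | Δ`, up to renaming of bound
variables. The most recently bound variable is the first entry of its environment. -/
inductive Term (S : Signature.{u, v}) :
    Env S.TyConst → Env S.TyConst → Ty S.TyConst → Type (max u v)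
  | const {Γ Δ : Env S.TyConst} {A : Ty S.TyConst} (c : S.Const A) : Term S Γ Δ A
  | var {Γ Δ : Env S.TyConst} {A : Ty S.TyConst} (x : Var Γ A) : Term S Γ Δ A
  | lam {Γ Δ : Env S.TyConst} {B A : Ty S.TyConst} (M : Term S (B :: Γ) Δ A) :
      Term S Γ Δ (Ty.arrow B A)
  | app {Γ Δ : Env S.TyConst} {B A : Ty S.TyConst} (M : Term S Γ Δ (Ty.arrow B A))
      (N : Term S Γ Δ B) : Term S Γ Δ A
  | unit {Γ Δ : Env S.TyConst} : Term S Γ Δ Ty.top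
  | pair {Γ Δ : Env S.TyConst} {A₁ A₂ : Ty S.TyConst} (M₁ : Term S Γ Δ A₁)
      (M₂ : Term S Γ Δ A₂) : Term S Γ Δ (Ty.prod A₁ A₂)
  | fst {Γ Δ : Env S.TyConst} {A₁ A₂ : Ty S.TyConst} (M : Term S Γ Δ (Ty.prod A₁ A₂)) :
      Term S Γ Δ A₁
  | snd {Γ Δ : Env S.TyConst} {A₁ A₂ : Ty S.TyConst} (M : Term S Γ Δ (Ty.prod A₁ A₂)) :
      Term S Γ Δ A₂
  /-- `μa. M` -/
  | mu {Γ Δ : Env S.TyConst} {A : Ty S.TyConst} (M : Term S Γ (A :: Δ) Ty.bot) : Term S Γ Δ A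
  /-- `a M` -/
  | named {Γ Δ : Env S.TyConst} {A : Ty S.TyConst} (a : Var Δ A) (M : Term S Γ Δ A) :
      Term S Γ Δ Ty.bot
  /-- `μ(a₁, a₂). M` -/
  | mu₂ {Γ Δ : Env S.TyConst} {A₁ A₂ : Ty S.TyConst} (M : Term S Γ (A₁ :: A₂ :: Δ) Ty.bot) :
      Term S Γ Δ (Ty.or A₁ A₂)
  /-- `[a₁, a₂] M` -/
  | named₂ {Γ Δ : Env S.TyConst} {A₁ A₂ : Ty S.TyConst} (a₁ : Var Δ A₁) (a₂ : Var Δ A₂)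
      (M : Term S Γ Δ (Ty.or A₁ A₂)) : Term S Γ Δ Ty.bot

/-! ### Renaming and substitution -/

/-- A renaming of variables. -/
def Ren {K : Type u} (Γ Γ' : Env K) : Type u := ∀ ⦃A : Ty K⦄, Var Γ A → Var Γ' A

namespace Ren

def id {K : Type u} (Γ : Env K) : Ren Γ Γ := fun _ x => x

/-- The weakening by one variable. -/
def wk {K : Type u} {Γ : Env K} {B : Ty K} : Ren Γ (B :: Γ) := fun _ x => Var.succ x

/-- A renaming that is extended below a binder. -/
def lift {K : Type u} {Γ Γ' : Env K} {B : Ty K} (ρ : Ren Γ Γ') : Ren (B :: Γ) (B :: Γ')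
  | _, Var.zero => Var.zero
  | _, Var.succ x => Var.succ (ρ x)

/-- The renaming that sends the first variable to `b` and fixes the others. -/
def inst {K : Type u} {Γ : Env K} {B : Ty K} (b : Var Γ B) : Ren (B :: Γ) Γ
  | _, Var.zero => b
  | _, Var.succ x => x

/-- The renaming that sends the first two variables to `b₁`, `b₂` and fixes the others. -/
def inst₂ {K : Type u} {Γ : Env K} {B₁ B₂ : Ty K} (b₁ : Var Γ B₁) (b₂ : Var Γ B₂) :
    Ren (B₁ :: B₂ :: Γ) Γ
  | _, Var.zero => b₁
  | _, Var.succ x => inst b₂ x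

/-- The renaming from the empty environment. -/
def empty {K : Type u} (Γ : Env K) : Ren [] Γ := fun _ x => nomatch x

/-- Passing below a binder, where the first variable `A` of the target is to stay first. -/
def liftUnder {K : Type u} {Δ Δ' : Env K} {A B : Ty K} (r : Ren Δ (A :: Δ')) :
    Ren (B :: Δ) (A :: B :: Δ')
  | _, Var.zero => Var.succ Var.zero
  | _, Var.succ x => lift wk (r x)

end Ren

/-- Simultaneous renaming of variables and of control variables. -/
def Term.rename {S : Signature.{u, v}} {Γ Δ : Env S.TyConst} {A : Ty S.TyConst}
    (M : Term S Γ Δ A) {Γ' Δ' : Env S.TyConst} (ρ : Ren Γ Γ') (θ : Ren Δ Δ') : Term S Γ' Δ' A :=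
  match M with
  | .const c => .const c
  | .var x => .var (ρ x)
  | .lam M => .lam (M.rename ρ.lift θ)
  | .app M N => .app (M.rename ρ θ) (N.rename ρ θ)
  | .unit => .unit
  | .pair M₁ M₂ => .pair (M₁.rename ρ θ) (M₂.rename ρ θ)
  | .fst M => .fst (M.rename ρ θ)
  | .snd M => .snd (M.rename ρ θ)
  | .mu M => .mu (M.rename ρ θ.lift)
  | .named a M => .named (θ a) (M.rename ρ θ)
  | .mu₂ M => .mu₂ (M.rename ρ θ.lift.lift)
  | .named₂ a₁ a₂ M => .named₂ (θ a₁) (θ a₂) (M.rename ρ θ)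

/-- `M`, seen in an environment with one more variable. -/
def Term.wk {S : Signature.{u, v}} {Γ Δ : Env S.TyConst} {A B : Ty S.TyConst}
    (M : Term S Γ Δ A) : Term S (B :: Γ) Δ A := M.rename Ren.wk (Ren.id Δ)

/-- `M`, seen in an environment with one more control variable. -/
def Term.cwk {S : Signature.{u, v}} {Γ Δ : Env S.TyConst} {A B : Ty S.TyConst}
    (M : Term S Γ Δ A) : Term S Γ (B :: Δ) A := M.rename (Ren.id Γ) Ren.wk

/-- A closed term, seen in arbitrary environments. -/
def Term.weaken {S : Signature.{u, v}} {A : Ty S.TyConst} (M : Term S [] [] A)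
    (Γ Δ : Env S.TyConst) : Term S Γ Δ A := M.rename (Ren.empty Γ) (Ren.empty Δ)

/-- A simultaneous substitution of terms for variables. -/
def Sub (S : Signature.{u, v}) (Γ Γ' Δ : Env S.TyConst) : Type (max u v) :=
  ∀ ⦃A : Ty S.TyConst⦄, Var Γ A → Term S Γ' Δ A

namespace Sub

def lift {S : Signature.{u, v}} {Γ Γ' Δ : Env S.TyConst} {B : Ty S.TyConst}
    (σ : Sub S Γ Γ' Δ) : Sub S (B :: Γ) (B :: Γ') Δ
  | _, Var.zero => .var Var.zero
  | _, Var.succ x => (σ x).wk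

def cwk {S : Signature.{u, v}} {Γ Γ' Δ : Env S.TyConst} {B : Ty S.TyConst}
    (σ : Sub S Γ Γ' Δ) : Sub S Γ Γ' (B :: Δ) := fun _ x => (σ x).cwk

/-- The substitution of `N` for the first variable. -/
def single {S : Signature.{u, v}} {Γ Δ : Env S.TyConst} {B : Ty S.TyConst}
    (N : Term S Γ Δ B) : Sub S (B :: Γ) Γ Δ
  | _, Var.zero => N
  | _, Var.succ x => .var x

end Sub

/-- Capture-avoiding simultaneous substitution. -/
def Term.subst {S : Signature.{u, v}} {Γ Δ : Env S.TyConst} {A : Ty S.TyConst}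
    (M : Term S Γ Δ A) {Γ' : Env S.TyConst} (σ : Sub S Γ Γ' Δ) : Term S Γ' Δ A :=
  match M with
  | .const c => .const c
  | .var x => σ x
  | .lam M => .lam (M.subst σ.lift)
  | .app M N => .app (M.subst σ) (N.subst σ)
  | .unit => .unit
  | .pair M₁ M₂ => .pair (M₁.subst σ) (M₂.subst σ)
  | .fst M => .fst (M.subst σ)
  | .snd M => .snd (M.subst σ)
  | .mu M => .mu (M.subst σ.cwk)
  | .named a M => .named a (M.subst σ)
  | .mu₂ M => .mu₂ (M.subst σ.cwk.cwk)
  | .named₂ a₁ a₂ M => .named₂ a₁ a₂ (M.subst σ)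

/-! ### Term-contexts and the substitution `M[a□ := C]` -/

/-- Term-contexts with one hole of type `A`, which is not below a binder. -/
inductive Ctx (S : Signature.{u, v}) (Γ Δ : Env S.TyConst) (A : Ty S.TyConst) :
    Ty S.TyConst → Type (max u v)
  | hole : Ctx S Γ Δ A A
  | app {B B' : Ty S.TyConst} (C : Ctx S Γ Δ A (Ty.arrow B' B)) (N : Term S Γ Δ B') :
      Ctx S Γ Δ A B
  | arg {B B' : Ty S.TyConst} (F : Term S Γ Δ (Ty.arrow B' B)) (C : Ctx S Γ Δ A B') :
      Ctx S Γ Δ A B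
  | fst {B₁ B₂ : Ty S.TyConst} (C : Ctx S Γ Δ A (Ty.prod B₁ B₂)) : Ctx S Γ Δ A B₁
  | snd {B₁ B₂ : Ty S.TyConst} (C : Ctx S Γ Δ A (Ty.prod B₁ B₂)) : Ctx S Γ Δ A B₂
  | named {B : Ty S.TyConst} (b : Var Δ B) (C : Ctx S Γ Δ A B) : Ctx S Γ Δ A Ty.bot
  | named₂ {B₁ B₂ : Ty S.TyConst} (b₁ : Var Δ B₁) (b₂ : Var Δ B₂)
      (C : Ctx S Γ Δ A (Ty.or B₁ B₂)) : Ctx S Γ Δ A Ty.bot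

namespace Ctx

/-- `C[N]` -/
def plug {S : Signature.{u, v}} {Γ Δ : Env S.TyConst} {A B : Ty S.TyConst}
    (C : Ctx S Γ Δ A B) (N : Term S Γ Δ A) : Term S Γ Δ B :=
  match C with
  | hole => N
  | app C L => .app (C.plug N) L
  | arg F C => .app F (C.plug N)
  | fst C => .fst (C.plug N)
  | snd C => .snd (C.plug N)
  | named b C => .named b (C.plug N)
  | named₂ b₁ b₂ C => .named₂ b₁ b₂ (C.plug N)

def rename {S : Signature.{u, v}} {Γ Δ : Env S.TyConst} {A B : Ty S.TyConst}
    (C : Ctx S Γ Δ A B) {Γ' Δ' : Env S.TyConst} (ρ : Ren Γ Γ') (θ : Ren Δ Δ') :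
    Ctx S Γ' Δ' A B :=
  match C with
  | hole => hole
  | app C L => app (C.rename ρ θ) (L.rename ρ θ)
  | arg F C => arg (F.rename ρ θ) (C.rename ρ θ)
  | fst C => fst (C.rename ρ θ)
  | snd C => snd (C.rename ρ θ)
  | named b C => named (θ b) (C.rename ρ θ)
  | named₂ b₁ b₂ C => named₂ (θ b₁) (θ b₂) (C.rename ρ θ)

def wk {S : Signature.{u, v}} {Γ Δ : Env S.TyConst} {A B B' : Ty S.TyConst}
    (C : Ctx S Γ Δ A B) : Ctx S (B' :: Γ) Δ A B := C.rename Ren.wk (Ren.id Δ)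

def cwk {S : Signature.{u, v}} {Γ Δ : Env S.TyConst} {A B B' : Ty S.TyConst}
    (C : Ctx S Γ Δ A B) : Ctx S Γ (B' :: Δ) A B := C.rename (Ren.id Γ) Ren.wk

/-- What becomes of `b M`, where `M` is already treated and the first control variable is the one
to be replaced: `C[M]` for the first control variable, and `b M` for the others. -/
def fill {S : Signature.{u, v}} {Γ Δ : Env S.TyConst} {A B : Ty S.TyConst}
    (C : Ctx S Γ Δ A Ty.bot) (b : Var (A :: Δ) B) (M : Term S Γ Δ B) : Term S Γ Δ Ty.bot :=
  match b, M with
  | .zero, M => C.plug M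
  | .succ b, M => .named b M

/-- What becomes of `[b₁, b₂] M`, where `M` is already treated: if the control variable `a` to be
replaced is one of `b₁`, `b₂`, then `C[μa. [b₁, b₂] M]`, and otherwise `[b₁, b₂] M`. -/
def fill₂ {S : Signature.{u, v}} {Γ Δ : Env S.TyConst} {A B₁ B₂ : Ty S.TyConst}
    (C : Ctx S Γ Δ A Ty.bot) (b₁ : Var (A :: Δ) B₁) (b₂ : Var (A :: Δ) B₂)
    (M : Term S Γ Δ (Ty.or B₁ B₂)) : Term S Γ Δ Ty.bot :=
  match b₁, b₂, M with
  | .zero, b₂, M => C.plug (.mu (.named₂ .zero b₂ M.cwk))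
  | .succ b₁, .zero, M => C.plug (.mu (.named₂ (.succ b₁) .zero M.cwk))
  | .succ b₁, .succ b₂, M => .named₂ b₁ b₂ M

end Ctx

/-- The recursion behind `M[a□ := C]`. The renaming `r` says which control variables of `M` are
the one to be replaced (those that it sends to the first one), and what the others become. -/
def Term.msubst {S : Signature.{u, v}} {Γ Δ : Env S.TyConst} {B : Ty S.TyConst}
    (M : Term S Γ Δ B) {Δ' : Env S.TyConst} {A : Ty S.TyConst} (r : Ren Δ (A :: Δ'))
    (C : Ctx S Γ Δ' A Ty.bot) : Term S Γ Δ' B :=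
  match M with
  | .const c => .const c
  | .var x => .var x
  | .lam M => .lam (M.msubst r C.wk)
  | .app M N => .app (M.msubst r C) (N.msubst r C)
  | .unit => .unit
  | .pair M₁ M₂ => .pair (M₁.msubst r C) (M₂.msubst r C)
  | .fst M => .fst (M.msubst r C)
  | .snd M => .snd (M.msubst r C)
  | .mu M => .mu (M.msubst r.liftUnder C.cwk)
  | .named b M => C.fill (r b) (M.msubst r C)
  | .mu₂ M => .mu₂ (M.msubst r.liftUnder.liftUnder C.cwk.cwk)
  | .named₂ b₁ b₂ M => C.fill₂ (r b₁) (r b₂) (M.msubst r C)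

/-- `M[a□ := C]`, where `a` is the first control variable of `M` and does not occur in `C`. -/
def Term.csubst {S : Signature.{u, v}} {Γ Δ : Env S.TyConst} {A B : Ty S.TyConst}
    (M : Term S Γ (A :: Δ) B) (C : Ctx S Γ Δ A Ty.bot) : Term S Γ Δ B :=
  M.msubst (Ren.id (A :: Δ)) C

/-- `M[a□ := C]`, where `a` is the first control variable of `M` and `C` may use a fresh control
variable `b`, which takes the place of `a`. -/
def Term.csubstFresh {S : Signature.{u, v}} {Γ Δ : Env S.TyConst} {A A' B : Ty S.TyConst}
    (M : Term S Γ (A :: Δ) B) (C : Ctx S Γ (A' :: Δ) A Ty.bot) : Term S Γ (A' :: Δ) B :=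
  M.msubst (Ren.lift Ren.wk) C

/-! ### Equality and theories -/

/-- The axioms of the call-by-name λμ-calculus. -/
inductive Axm {S : Signature.{u, v}} : ∀ {Γ Δ : Env S.TyConst} {A : Ty S.TyConst},
    Term S Γ Δ A → Term S Γ Δ A → Prop
  /-- `(λx. M) N = M[x := N]` -/
  | beta {Γ Δ : Env S.TyConst} {A B : Ty S.TyConst} (M : Term S (B :: Γ) Δ A)
      (N : Term S Γ Δ B) : Axm (.app (.lam M) N) (M.subst (Sub.single N))
  /-- `λx. M x = M` -/
  | eta {Γ Δ : Env S.TyConst} {A B : Ty S.TyConst} (M : Term S Γ Δ (Ty.arrow B A)) :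
      Axm (.lam (.app M.wk (.var .zero))) M
  | fst_pair {Γ Δ : Env S.TyConst} {A₁ A₂ : Ty S.TyConst} (M₁ : Term S Γ Δ A₁)
      (M₂ : Term S Γ Δ A₂) : Axm (.fst (.pair M₁ M₂)) M₁
  | snd_pair {Γ Δ : Env S.TyConst} {A₁ A₂ : Ty S.TyConst} (M₁ : Term S Γ Δ A₁)
      (M₂ : Term S Γ Δ A₂) : Axm (.snd (.pair M₁ M₂)) M₂
  | pair_eta {Γ Δ : Env S.TyConst} {A₁ A₂ : Ty S.TyConst} (M : Term S Γ Δ (Ty.prod A₁ A₂)) :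
      Axm (.pair (.fst M) (.snd M)) M
  | unit_eta {Γ Δ : Env S.TyConst} (M : Term S Γ Δ Ty.top) : Axm .unit M
  /-- `b (μa. M) = M[a := b]` -/
  | named_mu {Γ Δ : Env S.TyConst} {A : Ty S.TyConst} (b : Var Δ A)
      (M : Term S Γ (A :: Δ) Ty.bot) : Axm (.named b (.mu M)) (M.rename (Ren.id Γ) (Ren.inst b))
  /-- `μa. a M = M` -/
  | mu_named {Γ Δ : Env S.TyConst} {A : Ty S.TyConst} (M : Term S Γ Δ A) :
      Axm (.mu (.named .zero M.cwk)) M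
  /-- `[b₁, b₂] (μ(a₁, a₂). M) = M[a₁, a₂ := b₁, b₂]` -/
  | named₂_mu₂ {Γ Δ : Env S.TyConst} {A₁ A₂ : Ty S.TyConst} (b₁ : Var Δ A₁) (b₂ : Var Δ A₂)
      (M : Term S Γ (A₁ :: A₂ :: Δ) Ty.bot) :
      Axm (.named₂ b₁ b₂ (.mu₂ M)) (M.rename (Ren.id Γ) (Ren.inst₂ b₁ b₂))
  /-- `μ(a₁, a₂). [a₁, a₂] M = M` -/
  | mu₂_named₂ {Γ Δ : Env S.TyConst} {A₁ A₂ : Ty S.TyConst} (M : Term S Γ Δ (Ty.or A₁ A₂)) :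
      Axm (.mu₂ (.named₂ .zero (.succ .zero) M.cwk.cwk)) M
  /-- `b M = M` for `b` of type `⊥` -/
  | named_bot {Γ Δ : Env S.TyConst} (b : Var Δ Ty.bot) (M : Term S Γ Δ Ty.bot) :
      Axm (.named b M) M
  /-- `(μa. M) N = μb. M[a□ := b (□ N)]` -/
  | mu_app {Γ Δ : Env S.TyConst} {A B : Ty S.TyConst}
      (M : Term S Γ (Ty.arrow B A :: Δ) Ty.bot) (N : Term S Γ Δ B) :
      Axm (.app (.mu M) N) (.mu (M.csubstFresh (.named .zero (.app .hole N.cwk))))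
  /-- `π₁ (μa. M) = μb. M[a□ := b (π₁ □)]` -/
  | fst_mu {Γ Δ : Env S.TyConst} {A₁ A₂ : Ty S.TyConst}
      (M : Term S Γ (Ty.prod A₁ A₂ :: Δ) Ty.bot) :
      Axm (.fst (.mu M)) (.mu (M.csubstFresh (.named .zero (.fst .hole))))
  /-- `π₂ (μa. M) = μb. M[a□ := b (π₂ □)]` -/
  | snd_mu {Γ Δ : Env S.TyConst} {A₁ A₂ : Ty S.TyConst}
      (M : Term S Γ (Ty.prod A₁ A₂ :: Δ) Ty.bot) :
      Axm (.snd (.mu M)) (.mu (M.csubstFresh (.named .zero (.snd .hole))))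
  /-- `[a₁, a₂] (μa. M) = M[a□ := [a₁, a₂] □]` -/
  | named₂_mu {Γ Δ : Env S.TyConst} {A₁ A₂ : Ty S.TyConst} (a₁ : Var Δ A₁) (a₂ : Var Δ A₂)
      (M : Term S Γ (Ty.or A₁ A₂ :: Δ) Ty.bot) :
      Axm (.named₂ a₁ a₂ (.mu M)) (M.csubst (.named₂ a₁ a₂ .hole))

/-- A λμ-theory: a congruence on typed terms in environments that contains the axioms, and that is
stable under enlarging and permuting the environments. -/
structure Theory (S : Signature.{u, v}) where
  Eq : ∀ {Γ Δ : Env S.TyConst} {A : Ty S.TyConst}, Term S Γ Δ A → Term S Γ Δ A → Prop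
  axm : ∀ {Γ Δ : Env S.TyConst} {A : Ty S.TyConst} {M N : Term S Γ Δ A}, Axm M N → Eq M N
  refl : ∀ {Γ Δ : Env S.TyConst} {A : Ty S.TyConst} (M : Term S Γ Δ A), Eq M M
  symm : ∀ {Γ Δ : Env S.TyConst} {A : Ty S.TyConst} {M N : Term S Γ Δ A}, Eq M N → Eq N M
  trans : ∀ {Γ Δ : Env S.TyConst} {A : Ty S.TyConst} {M N L : Term S Γ Δ A},
    Eq M N → Eq N L → Eq M L
  rename : ∀ {Γ Δ Γ' Δ' : Env S.TyConst} {A : Ty S.TyConst} {M N : Term S Γ Δ A}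
    (ρ : Ren Γ Γ') (θ : Ren Δ Δ'), Eq M N → Eq (M.rename ρ θ) (N.rename ρ θ)
  lam : ∀ {Γ Δ : Env S.TyConst} {A B : Ty S.TyConst} {M M' : Term S (B :: Γ) Δ A},
    Eq M M' → Eq (Term.lam M) (Term.lam M')
  app : ∀ {Γ Δ : Env S.TyConst} {A B : Ty S.TyConst} {M M' : Term S Γ Δ (Ty.arrow B A)}
    {N N' : Term S Γ Δ B}, Eq M M' → Eq N N' → Eq (Term.app M N) (Term.app M' N')
  pair : ∀ {Γ Δ : Env S.TyConst} {A₁ A₂ : Ty S.TyConst} {M M' : Term S Γ Δ A₁}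
    {N N' : Term S Γ Δ A₂}, Eq M M' → Eq N N' → Eq (Term.pair M N) (Term.pair M' N')
  fst : ∀ {Γ Δ : Env S.TyConst} {A₁ A₂ : Ty S.TyConst} {M M' : Term S Γ Δ (Ty.prod A₁ A₂)},
    Eq M M' → Eq (Term.fst M) (Term.fst M')
  snd : ∀ {Γ Δ : Env S.TyConst} {A₁ A₂ : Ty S.TyConst} {M M' : Term S Γ Δ (Ty.prod A₁ A₂)},
    Eq M M' → Eq (Term.snd M) (Term.snd M')
  mu : ∀ {Γ Δ : Env S.TyConst} {A : Ty S.TyConst} {M M' : Term S Γ (A :: Δ) Ty.bot},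
    Eq M M' → Eq (Term.mu M) (Term.mu M')
  named : ∀ {Γ Δ : Env S.TyConst} {A : Ty S.TyConst} (a : Var Δ A) {M M' : Term S Γ Δ A},
    Eq M M' → Eq (Term.named a M) (Term.named a M')
  mu₂ : ∀ {Γ Δ : Env S.TyConst} {A₁ A₂ : Ty S.TyConst}
    {M M' : Term S Γ (A₁ :: A₂ :: Δ) Ty.bot}, Eq M M' → Eq (Term.mu₂ M) (Term.mu₂ M')
  named₂ : ∀ {Γ Δ : Env S.TyConst} {A₁ A₂ : Ty S.TyConst} (a₁ : Var Δ A₁) (a₂ : Var Δ A₂)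
    {M M' : Term S Γ Δ (Ty.or A₁ A₂)}, Eq M M' → Eq (Term.named₂ a₁ a₂ M) (Term.named₂ a₁ a₂ M')

/-! ### Functions, focal functions -/

/-- A function from `B` to `A`: a closed term of type `B → A`. -/
abbrev Fn (S : Signature.{u, v}) (B A : Ty S.TyConst) : Type (max u v) :=
  Term S [] [] (Ty.arrow B A)

namespace Fn

/-- The identity function `λx. x`. -/
def id {S : Signature.{u, v}} (A : Ty S.TyConst) : Fn S A A := .lam (.var .zero)

/-- The composite `g ∘ f = λx. g (f x)`. -/
def comp {S : Signature.{u, v}} {A B C : Ty S.TyConst} (g : Fn S B C) (f : Fn S A B) :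
    Fn S A C :=
  .lam (.app (g.weaken _ _) (.app (f.weaken _ _) (.var .zero)))

/-- `¬F = λk. λx. k (F x) : ¬A → ¬B` for `F : B → A`. -/
def neg {S : Signature.{u, v}} {B A : Ty S.TyConst} (F : Fn S B A) : Fn S A.not B.not :=
  .lam (.lam (.app (.var (.succ .zero)) (.app (F.weaken _ _) (.var .zero))))

end Fn

/-- `F` is focal if `F (μa. M) = μb. M[a□ := b (F □)]` for every term `M`. -/
def Focal {S : Signature.{u, v}} (T : Theory S) {B A : Ty S.TyConst} (F : Fn S B A) : Prop :=
  ∀ {Γ Δ : Env S.TyConst} (M : Term S Γ (B :: Δ) Ty.bot),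
    T.Eq (.app (F.weaken Γ Δ) (.mu M))
      (.mu (M.csubstFresh (.named .zero (.arg (F.weaken Γ (A :: Δ)) .hole))))


/-! ### Helper facts: composites of focal functions, and all functions `¬F`, are focal -/

section lemmas
variable {S : Signature.{u, v}}

theorem Ren.lift_eq {K : Type u} {Γ₁ Γ₂ Γ₃ : Env K} {B : Ty K} {ρ : Ren Γ₁ Γ₂} {ρ' : Ren Γ₂ Γ₃} {ρ'' : Ren Γ₁ Γ₃}
    (h : ∀ A (x : Var Γ₁ A), ρ' (ρ x) = ρ'' x) :
    ∀ A (x : Var (B :: Γ₁) A), ρ'.lift (ρ.lift x) = ρ''.lift x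
  | _, .zero => rfl
  | _, .succ x => by simp [Ren.lift, h]

theorem Term.rename_rename {Γ Δ : Env S.TyConst} {A : Ty S.TyConst} (M : Term S Γ Δ A) :
    ∀ {Γ₁ Δ₁ Γ₂ Δ₂ : Env S.TyConst} {ρ : Ren Γ Γ₁} {θ : Ren Δ Δ₁} {ρ' : Ren Γ₁ Γ₂} {θ' : Ren Δ₁ Δ₂}
    {ρ'' : Ren Γ Γ₂} {θ'' : Ren Δ Δ₂}, (∀ A (x : Var Γ A), ρ' (ρ x) = ρ'' x) →
    (∀ A (x : Var Δ A), θ' (θ x) = θ'' x) →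
    (M.rename ρ θ).rename ρ' θ' = M.rename ρ'' θ'' := by
  induction M with
  | const c => intros; rfl
  | unit => intros; rfl
  | var x => intros; simp_all [Term.rename]
  | lam M ih => intro _ _ _ _ _ _ _ _ _ _ h k; simp [Term.rename, ih (Ren.lift_eq h) k]
  | mu M ih => intro _ _ _ _ _ _ _ _ _ _ h k; simp [Term.rename, ih h (Ren.lift_eq k)]
  | mu₂ M ih => intro _ _ _ _ _ _ _ _ _ _ h k; simp [Term.rename, ih h (Ren.lift_eq (Ren.lift_eq k))]
  | app M N ih ih' => intro _ _ _ _ _ _ _ _ _ _ h k; simp [Term.rename, ih h k, ih' h k]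
  | pair M N ih ih' => intro _ _ _ _ _ _ _ _ _ _ h k; simp [Term.rename, ih h k, ih' h k]
  | fst M ih => intro _ _ _ _ _ _ _ _ _ _ h k; simp [Term.rename, ih h k]
  | snd M ih => intro _ _ _ _ _ _ _ _ _ _ h k; simp [Term.rename, ih h k]
  | named a M ih => intro _ _ _ _ _ _ _ _ _ _ h k; simp [Term.rename, ih h k, k]
  | named₂ a b M ih => intro _ _ _ _ _ _ _ _ _ _ h k; simp [Term.rename, ih h k, k]

theorem Term.weaken_rename {A : Ty S.TyConst} (M : Term S [] [] A) {Γ Δ Γ' Δ' : Env S.TyConst}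
    (ρ : Ren Γ Γ') (θ : Ren Δ Δ') : (M.weaken Γ Δ).rename ρ θ = M.weaken Γ' Δ' :=
  M.rename_rename (fun _ x => nomatch x) (fun _ x => nomatch x)

theorem Ctx.rename_rename {Γ Δ : Env S.TyConst} {A B : Ty S.TyConst} (C : Ctx S Γ Δ A B)
    {Γ₁ Δ₁ Γ₂ Δ₂ : Env S.TyConst} {ρ : Ren Γ Γ₁} {θ : Ren Δ Δ₁} {ρ' : Ren Γ₁ Γ₂} {θ' : Ren Δ₁ Δ₂}
    {ρ'' : Ren Γ Γ₂} {θ'' : Ren Δ Δ₂} (h : ∀ A (x : Var Γ A), ρ' (ρ x) = ρ'' x)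
    (k : ∀ A (x : Var Δ A), θ' (θ x) = θ'' x) :
    (C.rename ρ θ).rename ρ' θ' = C.rename ρ'' θ'' := by
  induction C <;> simp_all [Ctx.rename, Term.rename_rename _ h k]

theorem Ctx.plug_rename {Γ Δ : Env S.TyConst} {A B : Ty S.TyConst} (C : Ctx S Γ Δ A B)
    (N : Term S Γ Δ A) {Γ' Δ' : Env S.TyConst} (ρ : Ren Γ Γ') (θ : Ren Δ Δ') :
    (C.plug N).rename ρ θ = (C.rename ρ θ).plug (N.rename ρ θ) := by
  induction C <;> simp_all [Ctx.rename, Ctx.plug, Term.rename]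

theorem Term.subst_rename {Γ Δ : Env S.TyConst} {A : Ty S.TyConst} (M : Term S Γ Δ A) :
    ∀ {Γ₁ Δ₁ Γ₂ : Env S.TyConst} {ρ : Ren Γ Γ₁} {θ : Ren Δ Δ₁} {σ : Sub S Γ₁ Γ₂ Δ₁}
    {ρ' : Ren Γ Γ₂}, (∀ A (x : Var Γ A), σ (ρ x) = .var (ρ' x)) →
    (M.rename ρ θ).subst σ = M.rename ρ' θ := by
  have hl : ∀ {Γ Γ₁ Δ₁ Γ₂ : Env S.TyConst} {B} {ρ : Ren Γ Γ₁} {σ : Sub S Γ₁ Γ₂ Δ₁}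
    {ρ' : Ren Γ Γ₂}, (∀ A (x : Var Γ A), σ (ρ x) = .var (ρ' x)) →
      ∀ A (x : Var (B :: Γ) A), σ.lift (ρ.lift x) = .var (ρ'.lift x) := by
    intro _ _ _ _ _ _ _ _ h A x
    cases x <;> simp [Ren.lift, Sub.lift, h, Term.wk, Term.rename, Ren.wk]
  have hc : ∀ {Γ Γ₁ Δ₁ Γ₂ : Env S.TyConst} {B : Ty S.TyConst} {ρ : Ren Γ Γ₁} {σ : Sub S Γ₁ Γ₂ Δ₁}
    {ρ' : Ren Γ Γ₂}, (∀ A (x : Var Γ A), σ (ρ x) = .var (ρ' x)) →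
      ∀ A (x : Var Γ A), (σ.cwk (B := B)) (ρ x) = .var (ρ' x) := by
    intro _ _ _ _ _ _ _ _ h A x
    simp [Sub.cwk, h, Term.cwk, Term.rename, Ren.id]
  induction M with
  | const c => intros; rfl
  | unit => intros; rfl
  | var x => intro _ _ _ _ _ _ _ h; simp [Term.rename, Term.subst, h]
  | lam M ih => intro _ _ _ _ _ _ _ h; simp [Term.rename, Term.subst, ih (hl h)]
  | mu M ih => intro _ _ _ _ _ _ _ h; simp [Term.rename, Term.subst, ih (hc h)]
  | mu₂ M ih => intro _ _ _ _ _ _ _ h; simp [Term.rename, Term.subst, ih (hc (hc h))]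
  | app M N ih ih' => intro _ _ _ _ _ _ _ h; simp [Term.rename, Term.subst, ih h, ih' h]
  | pair M N ih ih' => intro _ _ _ _ _ _ _ h; simp [Term.rename, Term.subst, ih h, ih' h]
  | fst M ih => intro _ _ _ _ _ _ _ h; simp [Term.rename, Term.subst, ih h]
  | snd M ih => intro _ _ _ _ _ _ _ h; simp [Term.rename, Term.subst, ih h]
  | named a M ih => intro _ _ _ _ _ _ _ h; simp [Term.rename, Term.subst, ih h]
  | named₂ a b M ih => intro _ _ _ _ _ _ _ h; simp [Term.rename, Term.subst, ih h]

theorem Ren.lift_id {K : Type u} {Γ : Env K} {B : Ty K} :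
    Ren.lift (B := B) (Ren.id Γ) = Ren.id (B :: Γ) := by
  funext A x; cases x <;> rfl

theorem Term.rename_id {Γ Δ : Env S.TyConst} {A : Ty S.TyConst} (M : Term S Γ Δ A) :
    M.rename (Ren.id Γ) (Ren.id Δ) = M := by
  induction M <;> simp_all [Term.rename, Ren.lift_id] <;> simp [Ren.id]

theorem Term.weaken_subst {A : Ty S.TyConst} (M : Term S [] [] A) {Γ Δ Γ' : Env S.TyConst}
    (σ : Sub S Γ Γ' Δ) : (M.weaken Γ Δ).subst σ = M.weaken Γ' Δ :=
  M.subst_rename (fun _ x => nomatch x)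

theorem Term.wk_subst_single {Γ Δ : Env S.TyConst} {A B : Ty S.TyConst} (M : Term S Γ Δ A)
    (N : Term S Γ Δ B) : M.wk.subst (Sub.single N) = M := by
  exact (Term.subst_rename (ρ := Ren.wk) (σ := Sub.single N) (ρ' := Ren.id Γ) M (fun _ x => rfl)).trans M.rename_id

theorem Ctx.fill_rename {Γ Δ Γ' Δ' : Env S.TyConst} {A B : Ty S.TyConst}
    (C : Ctx S Γ Δ A Ty.bot) (b : Var (A :: Δ) B) (M : Term S Γ Δ B) (ρ : Ren Γ Γ') (θ : Ren Δ Δ') :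
    (C.fill b M).rename ρ θ = (C.rename ρ θ).fill (θ.lift b) (M.rename ρ θ) := by
  cases b <;> simp [Ctx.fill, Ctx.plug_rename, Ren.lift, Term.rename]

theorem Term.cwk_rename {Γ Δ Γ' Δ' : Env S.TyConst} {A B : Ty S.TyConst}
    (M : Term S Γ Δ A) (ρ : Ren Γ Γ') (θ : Ren Δ Δ') :
    (M.cwk (B := B)).rename ρ θ.lift = (M.rename ρ θ).cwk := by
  rw [Term.cwk, Term.cwk, M.rename_rename (ρ'' := ρ) (θ'' := fun _ x => .succ (θ x)),
    M.rename_rename] <;> intros <;> rfl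

theorem Ctx.cwk_rename {Γ Δ Γ' Δ' : Env S.TyConst} {A A' B : Ty S.TyConst}
    (M : Ctx S Γ Δ A A') (ρ : Ren Γ Γ') (θ : Ren Δ Δ') :
    (M.cwk (B' := B)).rename ρ θ.lift = (M.rename ρ θ).cwk := by
  rw [Ctx.cwk, Ctx.cwk, M.rename_rename (ρ'' := ρ) (θ'' := fun _ x => .succ (θ x)),
    M.rename_rename] <;> intros <;> rfl

theorem Ctx.wk_rename {Γ Δ Γ' Δ' : Env S.TyConst} {A A' B : Ty S.TyConst}
    (M : Ctx S Γ Δ A A') (ρ : Ren Γ Γ') (θ : Ren Δ Δ') :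
    (M.wk (B' := B)).rename ρ.lift θ = (M.rename ρ θ).wk := by
  rw [Ctx.wk, Ctx.wk, M.rename_rename (ρ'' := fun _ x => .succ (ρ x)) (θ'' := θ),
    M.rename_rename] <;> intros <;> rfl

theorem Ctx.fill₂_rename {Γ Δ Γ' Δ' : Env S.TyConst} {A B₁ B₂ : Ty S.TyConst}
    (C : Ctx S Γ Δ A Ty.bot) (b₁ : Var (A :: Δ) B₁) (b₂ : Var (A :: Δ) B₂) (M : Term S Γ Δ _) (ρ : Ren Γ Γ') (θ : Ren Δ Δ') :
    (C.fill₂ b₁ b₂ M).rename ρ θ = (C.rename ρ θ).fill₂ (θ.lift b₁) (θ.lift b₂) (M.rename ρ θ) := by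
  cases b₁ <;> cases b₂ <;>
    simp [Ctx.fill₂, Ctx.plug_rename, Ren.lift, Term.rename, Term.cwk_rename]

theorem liftUnder_rel {K : Type u} {Δ Δ₁ Δ' Δ₁' : Env K} {A B : Ty K} {r : Ren Δ (A :: Δ')}
    {θ : Ren Δ Δ₁} {θ' : Ren Δ' Δ₁'} {r' : Ren Δ₁ (A :: Δ₁')}
    (h : ∀ B (x : Var Δ B), θ'.lift (r x) = r' (θ x)) :
    ∀ B' (x : Var (B :: Δ) B'), θ'.lift.lift (r.liftUnder x) = r'.liftUnder (θ.lift x)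
  | _, .zero => rfl
  | _, .succ x => by
    simp only [Ren.liftUnder, Ren.lift, ← h]
    cases r x <;> rfl

theorem Term.msubst_rename {Γ Δ : Env S.TyConst} {B : Ty S.TyConst} (M : Term S Γ Δ B) :
    ∀ {A : Ty S.TyConst} {Δ' Γ₁ Δ₁ Δ₁' : Env S.TyConst} {r : Ren Δ (A :: Δ')} {C : Ctx S Γ Δ' A Ty.bot}
    {ρ : Ren Γ Γ₁} {θ : Ren Δ Δ₁} {θ' : Ren Δ' Δ₁'} {r' : Ren Δ₁ (A :: Δ₁')},
    (∀ B (x : Var Δ B), θ'.lift (r x) = r' (θ x)) →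
    (M.msubst r C).rename ρ θ' = (M.rename ρ θ).msubst r' (C.rename ρ θ') := by
  induction M with
  | const c => intros; rfl
  | unit => intros; rfl
  | var x => intros; rfl
  | lam M ih => intro _ _ _ _ _ _ _ _ _ _ _ h; simp [Term.rename, Term.msubst, ih h, Ctx.wk_rename]
  | mu M ih => intro _ _ _ _ _ _ _ _ _ _ _ h; simp [Term.rename, Term.msubst, ih (liftUnder_rel h), Ctx.cwk_rename]
  | mu₂ M ih => intro _ _ _ _ _ _ _ _ _ _ _ h; simp [Term.rename, Term.msubst, ih (liftUnder_rel (liftUnder_rel h)), Ctx.cwk_rename]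
  | app M N ih ih' => intro _ _ _ _ _ _ _ _ _ _ _ h; simp [Term.rename, Term.msubst, ih h, ih' h]
  | pair M N ih ih' => intro _ _ _ _ _ _ _ _ _ _ _ h; simp [Term.rename, Term.msubst, ih h, ih' h]
  | fst M ih => intro _ _ _ _ _ _ _ _ _ _ _ h; simp [Term.rename, Term.msubst, ih h]
  | snd M ih => intro _ _ _ _ _ _ _ _ _ _ _ h; simp [Term.rename, Term.msubst, ih h]
  | named a M ih => intro _ _ _ _ _ _ _ _ _ _ _ h; simp [Term.rename, Term.msubst, ih h, Ctx.fill_rename, h]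
  | named₂ a b M ih => intro _ _ _ _ _ _ _ _ _ _ _ h; simp [Term.rename, Term.msubst, ih h, Ctx.fill₂_rename, h]

theorem liftUnder_avoid {K : Type u} {Δ Δ₁ Δ' : Env K} {A B : Ty K} {θ : Ren Δ Δ₁}
    {r : Ren Δ₁ (A :: Δ')} {θ' : Ren Δ Δ'} (h : ∀ B (x : Var Δ B), r (θ x) = .succ (θ' x)) :
    ∀ B' (x : Var (B :: Δ) B'), r.liftUnder (θ.lift x) = .succ (θ'.lift x)
  | _, .zero => rfl
  | _, .succ x => by simp [Ren.liftUnder, Ren.lift, h, Ren.wk]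

theorem Term.rename_msubst_avoid {Γ Δ : Env S.TyConst} {B : Ty S.TyConst} (M : Term S Γ Δ B) :
    ∀ {A : Ty S.TyConst} {Δ' Γ₁ Δ₁ : Env S.TyConst} {ρ : Ren Γ Γ₁} {θ : Ren Δ Δ₁}
    {r : Ren Δ₁ (A :: Δ')} {C : Ctx S Γ₁ Δ' A Ty.bot} {θ' : Ren Δ Δ'},
    (∀ B (x : Var Δ B), r (θ x) = .succ (θ' x)) →
    (M.rename ρ θ).msubst r C = M.rename ρ θ' := by
  induction M with
  | const c => intros; rfl
  | unit => intros; rfl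
  | var x => intros; rfl
  | lam M ih => intro _ _ _ _ _ _ _ _ _ h; simp [Term.rename, Term.msubst, ih h]
  | mu M ih => intro _ _ _ _ _ _ _ _ _ h; simp [Term.rename, Term.msubst, ih (liftUnder_avoid h)]
  | mu₂ M ih => intro _ _ _ _ _ _ _ _ _ h; simp [Term.rename, Term.msubst, ih (liftUnder_avoid (liftUnder_avoid h))]
  | app M N ih ih' => intro _ _ _ _ _ _ _ _ _ h; simp [Term.rename, Term.msubst, ih h, ih' h]
  | pair M N ih ih' => intro _ _ _ _ _ _ _ _ _ h; simp [Term.rename, Term.msubst, ih h, ih' h]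
  | fst M ih => intro _ _ _ _ _ _ _ _ _ h; simp [Term.rename, Term.msubst, ih h]
  | snd M ih => intro _ _ _ _ _ _ _ _ _ h; simp [Term.rename, Term.msubst, ih h]
  | named a M ih => intro _ _ _ _ _ _ _ _ _ h; simp [Term.rename, Term.msubst, ih h, Ctx.fill, h]
  | named₂ a b M ih => intro _ _ _ _ _ _ _ _ _ h; simp [Term.rename, Term.msubst, ih h, Ctx.fill₂, h]

inductive FuseRel {K : Type u} {A A' : Ty K} {Δ' Δ'' : Env K} (r' : Ren Δ' (A' :: Δ'')) :
    ∀ {B : Ty K}, Var (A :: Δ') B → Var (A :: Δ'') B → Prop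
  | zero : FuseRel r' .zero .zero
  | succ {B : Ty K} (w : Var Δ' B) (u : Var Δ'' B) (h : r' w = .succ u) :
      FuseRel r' (.succ w) (.succ u)

theorem FuseRel.liftUnder {K : Type u} {A A' B : Ty K} {Δ Δ' Δ'' : Env K} {r' : Ren Δ' (A' :: Δ'')}
    {r : Ren Δ (A :: Δ')} {r'' : Ren Δ (A :: Δ'')}
    (h : ∀ B (x : Var Δ B), FuseRel r' (r x) (r'' x)) :
    ∀ B' (x : Var (B :: Δ) B'), FuseRel r'.liftUnder (r.liftUnder x) (r''.liftUnder x)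
  | _, .zero => .succ _ _ rfl
  | _, .succ x => by
    have := h _ x
    simp only [Ren.liftUnder]
    generalize r x = p at this
    generalize r'' x = q at this
    cases this with
    | zero => exact .zero
    | succ w u h => exact .succ _ _ (by simp [Ren.liftUnder, Ren.wk, h, Ren.lift])

structure FuseHyp (T : Theory S) {Γ Δ : Env S.TyConst} {A A' : Ty S.TyConst} (F : Fn S A A')
    (C : Ctx S Γ Δ A' Ty.bot) (D : Ctx S Γ Δ A Ty.bot) : Prop where
  eq : ∀ {Γ₁ Δ₁ : Env S.TyConst} (ρ : Ren Γ Γ₁) (θ : Ren Δ Δ₁) (N : Term S Γ₁ Δ₁ A),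
    T.Eq ((C.rename ρ θ).plug (.app (F.weaken _ _) N)) ((D.rename ρ θ).plug N)

theorem FuseHyp.rename {T : Theory S} {Γ Δ : Env S.TyConst} {A A' : Ty S.TyConst} {F : Fn S A A'}
    {C : Ctx S Γ Δ A' Ty.bot} {D : Ctx S Γ Δ A Ty.bot} (h : FuseHyp T F C D)
    {Γ₁ Δ₁ : Env S.TyConst} (ρ : Ren Γ Γ₁) (θ : Ren Δ Δ₁) :
    FuseHyp T F (C.rename ρ θ) (D.rename ρ θ) := by
  refine ⟨fun ρ' θ' N => ?_⟩
  rw [C.rename_rename (fun _ _ => rfl) (fun _ _ => rfl),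
    D.rename_rename (fun _ _ => rfl) (fun _ _ => rfl)]
  exact h.eq (fun _ x => ρ' (ρ x)) (fun _ x => θ' (θ x)) N

theorem Ctx.rename_id {Γ Δ : Env S.TyConst} {A B : Ty S.TyConst} (C : Ctx S Γ Δ A B) :
    C.rename (Ren.id Γ) (Ren.id Δ) = C := by
  induction C <;> simp_all [Ctx.rename, Term.rename_id] <;> simp [Ren.id]

theorem Ctx.plug_congr (T : Theory S) {Γ Δ : Env S.TyConst} {A B : Ty S.TyConst} (C : Ctx S Γ Δ A B)
    {M N : Term S Γ Δ A} (h : T.Eq M N) : T.Eq (C.plug M) (C.plug N) := by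
  induction C with
  | hole => exact h
  | app C L ih => exact T.app ih (T.refl _)
  | arg F C ih => exact T.app (T.refl _) ih
  | fst C ih => exact T.fst ih
  | snd C ih => exact T.snd ih
  | named a C ih => exact T.named _ ih
  | named₂ a b C ih => exact T.named₂ _ _ ih

theorem Term.cwk_msubst {Γ Δ Δ' : Env S.TyConst} {A B B' : Ty S.TyConst} (M : Term S Γ Δ B)
    (r : Ren Δ (A :: Δ')) (C : Ctx S Γ Δ' A Ty.bot) :
    (M.cwk (B := B')).msubst r.liftUnder C.cwk = (M.msubst r C).cwk :=
  (M.msubst_rename (ρ := Ren.id Γ) (θ := Ren.wk) (θ' := Ren.wk) (r' := r.liftUnder) (fun _ _ => rfl)).symm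

def Ctx.onArg {Γ Δ : Env S.TyConst} {A A' : Ty S.TyConst} (b : Var Δ A') (F : Fn S A A') :
    Ctx S Γ Δ A Ty.bot := .named b (.arg (F.weaken _ _) .hole)

theorem Ctx.onArg_rename {Γ Δ Γ' Δ' : Env S.TyConst} {A A' : Ty S.TyConst} (b : Var Δ A') (F : Fn S A A')
    (ρ : Ren Γ Γ') (θ : Ren Δ Δ') :
    (Ctx.onArg b F : Ctx S Γ Δ A Ty.bot).rename ρ θ = Ctx.onArg (θ b) F := by
  simp [Ctx.onArg, Ctx.rename, Term.weaken_rename]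

theorem Term.weaken_msubst {A : Ty S.TyConst} (M : Term S [] [] A) {Γ Δ Δ' : Env S.TyConst}
    {A' : Ty S.TyConst} (r : Ren Δ (A' :: Δ')) (C : Ctx S Γ Δ' A' Ty.bot) :
    (M.weaken Γ Δ).msubst r C = M.weaken Γ Δ' :=
  M.rename_msubst_avoid (fun _ x => nomatch x)

theorem Term.fuse (T : Theory S) {A A' : Ty S.TyConst} (F : Fn S A A') {Γ Δ : Env S.TyConst}
    {B : Ty S.TyConst} (M : Term S Γ Δ B) :
    ∀ {Δ' Δ'' : Env S.TyConst} {r : Ren Δ (A :: Δ')} {b : Var Δ' A'} {r' : Ren Δ' (A' :: Δ'')}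
    {C : Ctx S Γ Δ'' A' Ty.bot} {r'' : Ren Δ (A :: Δ'')} {D : Ctx S Γ Δ'' A Ty.bot},
    r' b = .zero → FuseHyp T F C D → (∀ B (x : Var Δ B), FuseRel r' (r x) (r'' x)) →
    T.Eq ((M.msubst r (Ctx.onArg b F)).msubst r' C) (M.msubst r'' D) := by
  induction M with
  | const c => intros; exact T.refl _
  | unit => intros; exact T.refl _
  | var x => intros; exact T.refl _
  | lam M ih =>
    intro _ _ _ _ _ _ _ _ h k l
    simp only [Term.msubst, Ctx.wk, Ctx.onArg_rename]
    exact T.lam (ih h (k.rename _ _) l)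
  | mu M ih =>
    intro _ _ _ _ _ _ _ _ h k l
    simp only [Term.msubst, Ctx.cwk, Ctx.onArg_rename]
    exact T.mu (ih (by simp [Ren.wk, Ren.liftUnder, h, Ren.lift]) (k.rename _ _) (FuseRel.liftUnder l))
  | mu₂ M ih =>
    intro _ _ _ _ _ _ _ _ h k l
    simp only [Term.msubst, Ctx.cwk, Ctx.onArg_rename]
    exact T.mu₂ (ih (by simp [Ren.wk, Ren.liftUnder, h, Ren.lift]) ((k.rename _ _).rename _ _)
      (FuseRel.liftUnder (FuseRel.liftUnder l)))
  | app M N ih ih' => intro _ _ _ _ _ _ _ _ h k l; exact T.app (ih h k l) (ih' h k l)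
  | pair M N ih ih' => intro _ _ _ _ _ _ _ _ h k l; exact T.pair (ih h k l) (ih' h k l)
  | fst M ih => intro _ _ _ _ _ _ _ _ h k l; exact T.fst (ih h k l)
  | snd M ih => intro _ _ _ _ _ _ _ _ h k l; exact T.snd (ih h k l)
  | named a M ih =>
    intro _ _ r b r' C r'' D h k l
    simp only [Term.msubst]
    have := ih h k l
    have l := l _ a
    revert l
    generalize r a = p
    generalize r'' a = q
    intro l
    have k := fun N => k.eq (Ren.id _) (Ren.id _) N
    simp only [Ctx.rename_id] at k
    cases l with
    | zero =>
      simp only [Ctx.fill, Ctx.onArg, Ctx.plug, Term.msubst, h, Term.weaken_msubst]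
      exact T.trans (k _) (Ctx.plug_congr _ _ this)
    | succ w u g =>
      simp only [Ctx.fill, Term.msubst, g]
      exact T.named _ this
  | named₂ a₁ a₂ M ih =>
    intro _ _ r b r' C r'' D h k l
    simp only [Term.msubst]
    have := ih h k l
    have l1 := l _ a₁
    have l2 := l _ a₂
    revert l1 l2
    generalize r a₁ = p
    generalize r'' a₁ = q
    generalize r a₂ = p'
    generalize r'' a₂ = q'
    intro l1 l2
    have k := fun N => k.eq (Ren.id _) (Ren.id _) N
    simp only [Ctx.rename_id] at k
    cases l1 with
    | zero =>
      cases l2 with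
      | zero =>
        simp only [Ctx.fill₂, Ctx.onArg, Ctx.plug, Ctx.fill, Term.msubst, h, Term.weaken_msubst, Term.cwk_msubst, Ren.liftUnder]
        exact T.trans (k _) (Ctx.plug_congr _ _ (T.mu (T.named₂ _ _ (T.rename _ _ this))))
      | succ w u g =>
        simp only [Ctx.fill₂, Ctx.onArg, Ctx.plug, Ctx.fill, Term.msubst, h, Term.weaken_msubst, Term.cwk_msubst, Ren.liftUnder, Ren.lift, Ren.wk, g]
        exact T.trans (k _) (Ctx.plug_congr _ _ (T.mu (T.named₂ _ _ (T.rename _ _ this))))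
    | succ w u g =>
      cases l2 with
      | zero =>
        simp only [Ctx.fill₂, Ctx.onArg, Ctx.plug, Ctx.fill, Term.msubst, h, Term.weaken_msubst, Term.cwk_msubst, Ren.liftUnder, Ren.lift, Ren.wk, g]
        exact T.trans (k _) (Ctx.plug_congr _ _ (T.mu (T.named₂ _ _ (T.rename _ _ this))))
      | succ w' u' g' =>
        simp only [Ctx.fill₂, Term.msubst, g, g']
        exact T.named₂ _ _ this

theorem liftwk_rel {K : Type u} {Δ : Env K} {A A' A'' : Ty K} (B : Ty K) (x : Var (A :: Δ) B) :
    FuseRel (Ren.lift (B := A') (Ren.wk (Γ := Δ) (B := A''))) (Ren.lift Ren.wk x)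
      (Ren.lift Ren.wk x) := by
  cases x with
  | zero => exact .zero
  | succ x => exact .succ _ _ rfl

theorem Fn.weaken_neg {B A : Ty S.TyConst} (F : Fn S B A) (Γ Δ : Env S.TyConst) :
    F.neg.weaken Γ Δ = .lam (.lam (.app (.var (.succ .zero)) (.app (F.weaken _ _) (.var .zero)))) := by
  conv_lhs => rw [Term.weaken, Fn.neg]
  simp only [Term.rename, Term.weaken_rename, Ren.lift]

theorem Fn.neg_app (T : Theory S) {B A : Ty S.TyConst} (F : Fn S B A) {Γ Δ : Env S.TyConst}
    (N : Term S Γ Δ A.not) : T.Eq (.app (F.neg.weaken Γ Δ) N)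
      (.lam (.app N.wk (.app (F.weaken _ _) (.var .zero)))) := by
  rw [Fn.weaken_neg]
  have := T.axm (Axm.beta (Term.lam (.app (.var (.succ .zero)) (.app (F.weaken _ _) (.var .zero)))) N)
  simpa only [Term.subst, Sub.lift, Sub.single, Term.weaken_subst] using this

theorem focal_neg (T : Theory S) {B A : Ty S.TyConst} (F : Fn S B A) : Focal T F.neg := by
  intro Γ Δ M
  refine T.trans (F.neg_app T _) (T.trans ?_ (T.axm (Axm.eta _)))
  refine T.lam ?_
  refine T.trans (T.axm (Axm.mu_app _ _)) (T.symm (T.trans (T.axm (Axm.mu_app _ _)) (T.mu (T.symm ?_))))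
  change T.Eq (Term.csubstFresh (M.rename _ (Ren.id Δ).lift) _) (Term.csubstFresh (Term.rename _ _ (Ren.id Δ).lift) _)
  rw [Term.csubstFresh, Term.csubstFresh, Term.csubstFresh]
  refine T.symm ?_
  have e0 : ∀ B' (x : Var (A.not :: Δ) B'), (Ren.lift (B := A.not) (Ren.lift (B := B.not) (Ren.id Δ))) (Ren.lift Ren.wk x) = Ren.lift Ren.wk ((Ren.id Δ).lift x) := by
    intro B x; cases x <;> rfl
  rw [Term.msubst_rename (r' := Ren.lift Ren.wk) (θ := (Ren.id Δ).lift) _ e0]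
  have e := Ctx.onArg_rename (Γ := Γ) (Γ' := B :: Γ) (Δ := _ :: Δ) (Var.zero) F.neg Ren.wk (Ren.lift (B := B.not) (Ren.id Δ))
  rw [Ctx.onArg] at e
  erw [e]
  refine Term.fuse T F.neg _ rfl ?_ liftwk_rel
  refine ⟨fun {Γ₁ Δ₁} ρ θ N => ?_⟩
  simp only [Ctx.rename, Ctx.plug, Term.cwk, Term.rename, Term.weaken_rename, Ren.id]
  refine T.named _ ?_
  refine T.trans (T.app (F.neg_app T N) (T.refl _)) ?_
  have := T.axm (Axm.beta (.app N.wk (.app (F.weaken _ _) (.var .zero))) (Term.var (Δ := Δ₁) (ρ Var.zero)))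
  simpa only [Term.subst, Term.wk_subst_single, Term.weaken_subst, Sub.single, Ren.id] using this


theorem Fn.comp_app (T : Theory S) {A B C : Ty S.TyConst} (g : Fn S B C) (f : Fn S A B)
    {Γ Δ : Env S.TyConst} (N : Term S Γ Δ A) : T.Eq (.app ((g.comp f).weaken Γ Δ) N)
      (.app (g.weaken Γ Δ) (.app (f.weaken Γ Δ) N)) := by
  have e : (g.comp f).weaken Γ Δ =
      .lam (.app (g.weaken _ _) (.app (f.weaken _ _) (.var .zero))) := by
    conv_lhs => rw [Term.weaken, Fn.comp]
    simp only [Term.rename, Term.weaken_rename, Ren.lift]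
  rw [e]
  have := T.axm (Axm.beta (.app (g.weaken _ _) (.app (f.weaken _ _) (.var .zero))) N)
  simpa only [Term.subst, Sub.single, Term.weaken_subst] using this

theorem focal_comp (T : Theory S) {A B C : Ty S.TyConst} {g : Fn S B C} {f : Fn S A B}
    (hg : Focal T g) (hf : Focal T f) : Focal T (g.comp f) := by
  intro Γ Δ M
  refine T.trans (g.comp_app T f _) (T.trans (T.app (T.refl _) (hf M)) (T.trans (hg _) (T.mu ?_)))
  refine Term.fuse T f M rfl ⟨fun ρ θ N => ?_⟩ liftwk_rel
  simp only [Ctx.rename, Ctx.plug, Term.weaken_rename]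
  exact T.named _ (T.symm (g.comp_app T f N))

end lemmas

/-- A focal function. -/
structure FocalFn {S : Signature.{u, v}} (T : Theory S) (B A : Ty S.TyConst) where
  fn : Fn S B A
  focal : Focal T fn

namespace FocalFn

/-- The composite of focal functions, which is focal. -/
def comp {S : Signature.{u, v}} {T : Theory S} {A B C : Ty S.TyConst} (g : FocalFn T B C)
    (f : FocalFn T A B) : FocalFn T A C := ⟨g.fn.comp f.fn, focal_comp T g.focal f.focal⟩

/-- `¬F`, which is focal for every function `F`. -/
def neg {S : Signature.{u, v}} (T : Theory S) {B A : Ty S.TyConst} (F : Fn S B A) :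
    FocalFn T A.not B.not := ⟨F.neg, focal_neg T F⟩

end FocalFn

/-! ### Functors, algebras and coalgebras -/

/-- A functor on a λμ-theory: a composition-preserving map on functions that also preserves focal
functions. (Preservation of identities is not required.) -/
structure Functor {S : Signature.{u, v}} (T : Theory S) where
  obj : Ty S.TyConst → Ty S.TyConst
  map : ∀ {B A : Ty S.TyConst}, Fn S B A → Fn S (obj B) (obj A)
  map_congr : ∀ {B A : Ty S.TyConst} {f f' : Fn S B A}, T.Eq f f' → T.Eq (map f) (map f')
  map_comp : ∀ {A B C : Ty S.TyConst} (g : Fn S B C) (f : Fn S A B),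
    T.Eq (map (g.comp f)) ((map g).comp (map f))
  map_focal : ∀ {B A : Ty S.TyConst} {f : Fn S B A}, Focal T f → Focal T (map f)

/-- A focus functor: a composition-preserving map on focal functions. -/
structure FocusFunctor {S : Signature.{u, v}} (T : Theory S) where
  obj : Ty S.TyConst → Ty S.TyConst
  map : ∀ {B A : Ty S.TyConst}, FocalFn T B A → FocalFn T (obj B) (obj A)
  map_congr : ∀ {B A : Ty S.TyConst} {f f' : FocalFn T B A},
    T.Eq f.fn f'.fn → T.Eq (map f).fn (map f').fn
  map_comp : ∀ {A B C : Ty S.TyConst} (g : FocalFn T B C) (f : FocalFn T A B),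
    T.Eq (map (g.comp f)).fn ((map g).comp (map f)).fn

/-- A natural isomorphism `¬Gα ≅ F(¬α)` of contravariant functors from all functions to focal
functions. -/
structure NegNatIso {S : Signature.{u, v}} {T : Theory S} (F : FocusFunctor T) (G : Functor T) where
  hom : ∀ A : Ty S.TyConst, FocalFn T (G.obj A).not (F.obj A.not)
  inv : ∀ A : Ty S.TyConst, FocalFn T (F.obj A.not) (G.obj A).not
  hom_inv : ∀ A : Ty S.TyConst, T.Eq ((inv A).comp (hom A)).fn (Fn.id (G.obj A).not)
  inv_hom : ∀ A : Ty S.TyConst, T.Eq ((hom A).comp (inv A)).fn (Fn.id (F.obj A.not))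
  natural : ∀ {B A : Ty S.TyConst} (f : Fn S B A),
    T.Eq ((F.map (FocalFn.neg T f)).comp (hom A)).fn ((hom B).comp (FocalFn.neg T (G.map f))).fn

/-- `X : C → G C` is a final `G`-coalgebra. -/
def IsFinalCoalgebra {S : Signature.{u, v}} {T : Theory S} (G : Functor T) {C : Ty S.TyConst}
    (X : Fn S C (G.obj C)) : Prop :=
  ∀ {A : Ty S.TyConst} (f : Fn S A (G.obj A)),
    ∃ h : Fn S A C, T.Eq (X.comp h) ((G.map h).comp f) ∧
      ∀ h' : Fn S A C, T.Eq (X.comp h') ((G.map h').comp f) → T.Eq h' h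

/-- `X : F C → C` is a focally initial `F`-algebra. -/
def IsFocallyInitialAlgebra {S : Signature.{u, v}} {T : Theory S} (F : FocusFunctor T)
    {C : Ty S.TyConst} (X : Fn S (F.obj C) C) : Prop :=
  Focal T X ∧ ∀ {A : Ty S.TyConst} (f : FocalFn T (F.obj A) A),
    ∃ h : FocalFn T C A, T.Eq (h.fn.comp X) (f.fn.comp (F.map h).fn) ∧
      ∀ h' : FocalFn T C A, T.Eq (h'.fn.comp X) (f.fn.comp (F.map h').fn) → T.Eq h'.fn h.fn

end LambdaMu

namespace LambdaMu

/-! ### Substitution lemmas for terms and term-contexts. -/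

section equational
variable {S : Signature.{u, v}}

/-! Classical double negation turns focality into an equation without binders. With `dne : ¬¬A → A`,
`dne k = μa. k (λx. a x)`, a function `f` is focal exactly when `f ∘ dne = dne ∘ ¬¬f`
(`Fn.dne_natural` and `focal_of_dne_natural`): the focal functions are the homomorphisms of the
algebras `dne` for the double-negation monad. The converse direction rests on `μa. M = dne (λk. M[a□
:= k □])` (`Term.dne_reify`), and it shows that `dne` itself is focal.

Hence every function `f : ¬C → A` has a focal transpose `dne ∘ ¬f : ¬A → C`, and transposing twice
gives `f` back when `f` is focal (`FocalFn.hom_transpose_transpose`).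

A focal algebra `f : FA → A` yields the focal function `p = f ∘ F(dne) ∘ φ : ¬G(¬A) → A`, and its
transpose is a `G`-coalgebra on `¬A`. If `h : ¬A → νG` is a coalgebra morphism into `X`, then
negating its square, composing with `dne` and using the naturality of `φ` make the transpose of `h`
an algebra morphism. Conversely, a focal algebra morphism `k : ¬νG → A` transposes to a coalgebra
morphism, since `X` and the image under `G` of the transpose are focal and so commute with `dne`.
Finality determines the transpose of `k`, and transposing again determines `k`. -/

theorem Term.rename_subst {Γ Δ : Env S.TyConst} {A : Ty S.TyConst} (M : Term S Γ Δ A) :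
    ∀ {Γ₁ Γ₂ Γ₃ Δ' : Env S.TyConst} {ρ : Ren Γ Γ₁} {θ : Ren Δ Δ'} {σ' : Sub S Γ₁ Γ₂ Δ'}
    {σ : Sub S Γ Γ₃ Δ} {ρ' : Ren Γ₃ Γ₂},
    (∀ B (x : Var Γ B), σ' (ρ x) = (σ x).rename ρ' θ) →
    (M.rename ρ θ).subst σ' = (M.subst σ).rename ρ' θ := by
  have hl : ∀ {Γ Γ₁ Γ₂ Γ₃ Δ Δ' : Env S.TyConst} {B : Ty S.TyConst} {ρ : Ren Γ Γ₁} {θ : Ren Δ Δ'}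
      {σ' : Sub S Γ₁ Γ₂ Δ'} {σ : Sub S Γ Γ₃ Δ} {ρ' : Ren Γ₃ Γ₂},
      (∀ B (x : Var Γ B), σ' (ρ x) = (σ x).rename ρ' θ) →
      ∀ B' (x : Var (B :: Γ) B'), σ'.lift (ρ.lift x) = (σ.lift x).rename ρ'.lift θ := by
    intro _ _ _ _ _ _ _ _ _ _ _ _ h _ x
    cases x with
    | zero => rfl
    | succ x =>
      simp only [Ren.lift, Sub.lift, h, Term.wk]
      rw [Term.rename_rename _ (fun _ _ => rfl) (fun _ _ => rfl),
        Term.rename_rename _ (fun _ _ => rfl) (fun _ _ => rfl)]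
      rfl
  have hc : ∀ {Γ Γ₁ Γ₂ Γ₃ Δ Δ' : Env S.TyConst} {B : Ty S.TyConst} {ρ : Ren Γ Γ₁} {θ : Ren Δ Δ'}
      {σ' : Sub S Γ₁ Γ₂ Δ'} {σ : Sub S Γ Γ₃ Δ} {ρ' : Ren Γ₃ Γ₂},
      (∀ B (x : Var Γ B), σ' (ρ x) = (σ x).rename ρ' θ) →
      ∀ B' (x : Var Γ B'), (σ'.cwk (B := B)) (ρ x) = (σ.cwk x).rename ρ' θ.lift := by
    intro _ _ _ _ _ _ _ _ _ _ _ _ h _ x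
    simp only [Sub.cwk, h, Term.cwk_rename]
  induction M with
  | const c => intros; rfl
  | unit => intros; rfl
  | var x => intro _ _ _ _ _ _ _ _ _ h; simp [Term.rename, Term.subst, h]
  | lam M ih => intro _ _ _ _ _ _ _ _ _ h; simp [Term.rename, Term.subst, ih (hl h)]
  | mu M ih => intro _ _ _ _ _ _ _ _ _ h; simp [Term.rename, Term.subst, ih (hc h)]
  | mu₂ M ih => intro _ _ _ _ _ _ _ _ _ h; simp [Term.rename, Term.subst, ih (hc (hc h))]
  | app M N ih ih' => intro _ _ _ _ _ _ _ _ _ h; simp [Term.rename, Term.subst, ih h, ih' h]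
  | pair M N ih ih' => intro _ _ _ _ _ _ _ _ _ h; simp [Term.rename, Term.subst, ih h, ih' h]
  | fst M ih => intro _ _ _ _ _ _ _ _ _ h; simp [Term.rename, Term.subst, ih h]
  | snd M ih => intro _ _ _ _ _ _ _ _ _ h; simp [Term.rename, Term.subst, ih h]
  | named a M ih => intro _ _ _ _ _ _ _ _ _ h; simp [Term.rename, Term.subst, ih h]
  | named₂ a b M ih => intro _ _ _ _ _ _ _ _ _ h; simp [Term.rename, Term.subst, ih h]

theorem Term.cwk_subst {Γ Γ' Δ : Env S.TyConst} {A B : Ty S.TyConst} (M : Term S Γ Δ A)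
    (σ : Sub S Γ Γ' Δ) : (M.cwk (B := B)).subst σ.cwk = (M.subst σ).cwk :=
  M.rename_subst (fun _ _ => rfl)

/-- Substituting `N` for the variable `k` in `M[a□ := k □]` yields `M[a□ := N □]`. -/
theorem Term.msubst_arg_subst {Γ Δ : Env S.TyConst} {B : Ty S.TyConst} (M : Term S Γ Δ B) :
    ∀ {A : Ty S.TyConst} {Γ₁ Δ' : Env S.TyConst} {r : Ren Δ (A :: Δ')} {ρ : Ren Γ Γ₁}
    {σ : Sub S Γ₁ Γ Δ'} {k : Var Γ₁ A.not} {N : Term S Γ Δ' A.not},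
    (∀ B (x : Var Γ B), σ (ρ x) = .var x) → σ k = N →
    ((M.rename ρ (Ren.id Δ)).msubst r (.arg (.var k) .hole)).subst σ =
      M.msubst r (.arg N .hole) := by
  induction M with
  | const c => intros; rfl
  | unit => intros; rfl
  | var x => intro _ _ _ _ _ _ _ _ h _; simp [Term.rename, Term.subst, Term.msubst, h]
  | lam M ih =>
    intro _ _ _ _ _ _ _ _ h e
    simp only [Term.rename, Term.subst, Term.msubst, Ctx.wk, Ctx.rename, Term.lam.injEq]
    refine ih ?_ ?_
    · intro _ x
      cases x with
      | zero => rfl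
      | succ x => simp only [Ren.lift, Sub.lift, h, Term.wk, Term.rename, Ren.wk]
    · simp only [Ren.wk, Sub.lift, e, Term.wk]
  | mu M ih =>
    intro _ _ _ _ _ _ _ _ h e
    simp only [Term.rename, Term.subst, Term.msubst, Ctx.cwk, Ctx.rename, Term.mu.injEq,
      Ren.lift_id]
    refine ih ?_ ?_
    · intro _ x
      simp only [Sub.cwk, h, Term.cwk, Term.rename, Ren.id]
    · simp only [Sub.cwk, Ren.id, e, Term.cwk]
  | mu₂ M ih =>
    intro _ _ _ _ _ _ _ _ h e
    simp only [Term.rename, Term.subst, Term.msubst, Ctx.cwk, Ctx.rename, Term.mu₂.injEq,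
      Ren.lift_id]
    refine ih ?_ ?_
    · intro _ x
      simp only [Sub.cwk, h, Term.cwk, Term.rename, Ren.id]
    · simp only [Sub.cwk, Ren.id, e, Term.cwk]
  | app M N ih ih' =>
    intro _ _ _ _ _ _ _ _ h e; simp [Term.rename, Term.subst, Term.msubst, ih h e, ih' h e]
  | pair M N ih ih' =>
    intro _ _ _ _ _ _ _ _ h e; simp [Term.rename, Term.subst, Term.msubst, ih h e, ih' h e]
  | fst M ih => intro _ _ _ _ _ _ _ _ h e; simp [Term.rename, Term.subst, Term.msubst, ih h e]
  | snd M ih => intro _ _ _ _ _ _ _ _ h e; simp [Term.rename, Term.subst, Term.msubst, ih h e]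
  | named a M ih =>
    intro _ _ _ r _ _ _ _ h e
    simp only [Term.rename, Term.msubst, Ren.id]
    rw [← ih h e]
    -- Only the naming clauses see the context: where the name is the replaced one, `σ` turns the
    -- head `k` into `N`.
    cases r a <;> simp [Ctx.fill, Ctx.plug, Term.subst, e]
  | named₂ a b M ih =>
    intro _ _ _ r _ _ _ _ h e
    simp only [Term.rename, Term.msubst, Ren.id]
    rw [← ih h e]
    -- Here the treated body sits below an extra `μ`, so `σ` acts on it in weakened form;
    -- `cwk_subst` takes the weakening out again.
    cases r a <;> cases r b <;> simp [Ctx.fill₂, Ctx.plug, Term.subst, e, Term.cwk_subst]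

theorem Term.cwk_rename_inst {Γ Δ : Env S.TyConst} {A B : Ty S.TyConst} (M : Term S Γ Δ A)
    (b : Var Δ B) : M.cwk.rename (Ren.id Γ) (Ren.inst b) = M :=
  (M.rename_rename (ρ := Ren.id Γ) (θ := Ren.wk) (ρ' := Ren.id Γ) (θ' := Ren.inst b)
    (ρ'' := Ren.id Γ) (θ'' := Ren.id Δ) (fun _ _ => rfl)
    (fun _ _ => rfl)).trans M.rename_id

/-! ### Equational laws of composition and of contravariant negation. -/

theorem Theory.beta (T : Theory S) {Γ Δ : Env S.TyConst} {A B : Ty S.TyConst}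
    (M : Term S (B :: Γ) Δ A) (N : Term S Γ Δ B) :
    T.Eq (.app (.lam M) N) (M.subst (Sub.single N)) := T.axm (.beta M N)

theorem Term.wk_eq_weaken {A B : Ty S.TyConst} (M : Term S [] [] A) :
    M.wk = M.weaken [B] [] := by
  have h : ∀ {Γ : Env S.TyConst} (ρ : Ren [] Γ), ρ = Ren.empty Γ := by
    intro _ ρ; funext _ x; exact nomatch x
  rw [Term.wk, Term.weaken, h Ren.wk, h (Ren.id [])]

/-- By η on both sides, it is enough to compare values at a generic variable. -/
theorem Fn.ext (T : Theory S) {A B : Ty S.TyConst} {f g : Fn S A B}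
    (h : T.Eq (.app (f.weaken [A] []) (.var .zero)) (.app (g.weaken [A] []) (.var .zero))) :
    T.Eq f g := by
  rw [← Term.wk_eq_weaken, ← Term.wk_eq_weaken] at h
  exact T.trans (T.symm (T.axm (.eta f))) (T.trans (T.lam h) (T.axm (.eta g)))

theorem Fn.app_congr (T : Theory S) {A B : Ty S.TyConst} {f g : Fn S A B} (h : T.Eq f g)
    {Γ Δ : Env S.TyConst} (N : Term S Γ Δ A) :
    T.Eq (.app (f.weaken Γ Δ) N) (.app (g.weaken Γ Δ) N) :=
  T.app (T.rename _ _ h) (T.refl _)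

theorem Fn.id_app (T : Theory S) {A : Ty S.TyConst} {Γ Δ : Env S.TyConst} (N : Term S Γ Δ A) :
    T.Eq (.app ((Fn.id A).weaken Γ Δ) N) N := T.beta (.var .zero) N

theorem Fn.comp_congr (T : Theory S) {A B C : Ty S.TyConst} {g g' : Fn S B C} {f f' : Fn S A B}
    (hg : T.Eq g g') (hf : T.Eq f f') : T.Eq (g.comp f) (g'.comp f') :=
  T.lam (T.app (T.rename _ _ hg) (T.app (T.rename _ _ hf) (T.refl _)))

theorem Fn.neg_congr (T : Theory S) {A B : Ty S.TyConst} {f f' : Fn S A B}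
    (hf : T.Eq f f') : T.Eq f.neg f'.neg :=
  T.lam (T.lam (T.app (T.refl _) (T.app (T.rename _ _ hf) (T.refl _))))

theorem Fn.neg_comp (T : Theory S) {A B C : Ty S.TyConst} (g : Fn S B C) (f : Fn S A B) :
    T.Eq (g.comp f).neg (f.neg.comp g.neg) := by
  refine Fn.ext T (T.trans (Fn.neg_app T _ _) (T.symm ?_))
  refine T.trans (Fn.comp_app T _ _ _) (T.trans (T.app (T.refl _) (Fn.neg_app T _ _)) ?_)
  refine T.trans (Fn.neg_app T _ _) (T.lam ?_)
  refine T.trans (T.beta _ _) (T.app (T.refl _) (T.symm ?_))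
  have := Fn.comp_app T g f (Term.var (Var.zero (Γ := [C.not])) : Term S (A :: [C.not]) [] A)
  simpa [Term.subst, Term.rename, Term.weaken_subst, Term.weaken_rename, Sub.single,
    Ren.lift] using this

theorem Fn.neg_id (T : Theory S) (A : Ty S.TyConst) :
    T.Eq (Fn.id A : Fn S A A).neg (Fn.id A.not) := by
  refine Fn.ext T (T.trans (Fn.neg_app T _ _) (T.trans ?_ (T.symm (Fn.id_app T _))))
  exact T.trans (T.lam (T.app (T.refl _) (Fn.id_app T _))) (T.axm (.eta _))

/-! ### Introduction and elimination of double negation. -/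

namespace Fn

/-- `λx. λk. k x : A → ¬¬A` -/
def dni (A : Ty S.TyConst) : Fn S A A.not.not :=
  .lam (.lam (.app (.var .zero) (.var (.succ .zero))))

/-- `λk. μa. k (λx. a x) : ¬¬A → A` -/
def dne (A : Ty S.TyConst) : Fn S A.not.not A :=
  .lam (.mu (.app (.var .zero) (.lam (.named .zero (.var .zero)))))

theorem dni_app (T : Theory S) {A : Ty S.TyConst} {Γ Δ : Env S.TyConst} (N : Term S Γ Δ A) :
    T.Eq (.app ((dni A).weaken Γ Δ) N) (.lam (.app (.var .zero) N.wk)) := T.beta _ _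

theorem dne_app (T : Theory S) {A : Ty S.TyConst} {Γ Δ : Env S.TyConst}
    (N : Term S Γ Δ A.not.not) :
    T.Eq (.app ((dne A).weaken Γ Δ) N) (.mu (.app N.cwk (.lam (.named .zero (.var .zero))))) :=
  T.beta _ _

/-- `b (dne N) = N (λx. b x)` -/
theorem named_dne (T : Theory S) {A : Ty S.TyConst} {Γ Δ : Env S.TyConst} (b : Var Δ A)
    (N : Term S Γ Δ A.not.not) :
    T.Eq (.named b (.app ((dne A).weaken Γ Δ) N)) (.app N (.lam (.named b (.var .zero)))) := by
  refine T.trans (T.named b (dne_app T N)) (T.trans (T.axm (.named_mu _ _)) ?_)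
  simp only [Term.rename, Term.cwk_rename_inst, Ren.lift, Ren.inst]
  exact T.refl _

theorem dne_dni (T : Theory S) (A : Ty S.TyConst) :
    T.Eq ((dne A).comp (dni A)) (Fn.id A) := by
  refine ext T (T.trans (comp_app T _ _ _) (T.trans ?_ (T.symm (id_app T _))))
  -- Expanding both sides to `μa. a (…)` supplies a name, which is what `named_dne` needs to
  -- eliminate `dne`.
  refine T.trans (T.symm (T.axm (.mu_named _))) (T.trans (T.mu ?_) (T.axm (.mu_named _)))
  simp only [Term.cwk, Term.rename, Term.weaken_rename]
  refine T.trans (named_dne T _ _) (T.trans (T.app (dni_app T _) (T.refl _)) ?_)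
  exact T.trans (T.beta _ _) (T.beta _ _)

/-- `¬¬f N L = N (λx. L (f x))` -/
theorem neg_neg_app_app (T : Theory S) {A B : Ty S.TyConst} (f : Fn S A B) {Γ Δ : Env S.TyConst}
    (N : Term S Γ Δ A.not.not) (L : Term S Γ Δ B.not) :
    T.Eq (.app (.app (f.neg.neg.weaken Γ Δ) N) L)
      (.app N (.lam (.app L.wk (.app (f.weaken _ _) (.var .zero))))) := by
  refine T.trans (T.app (neg_app T _ _) (T.refl _)) (T.trans (T.beta _ _) ?_)
  simp only [Term.subst, Term.wk_subst_single, Term.weaken_subst, Sub.single]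
  exact T.app (T.refl _) (neg_app T _ _)

/-- Focality is applied to the single `μ`-term `dne k = μa. k (λx. a x)`: it replaces `a x` by `b (f
x)`, and `¬¬f` does the same to the argument of `k`. -/
theorem dne_natural (T : Theory S) {A B : Ty S.TyConst} {f : Fn S A B} (hf : Focal T f) :
    T.Eq (f.comp (dne A)) ((dne B).comp f.neg.neg) := by
  refine ext T (T.trans (comp_app T _ _ _) (T.trans (T.app (T.refl _) (dne_app T _)) ?_))
  refine T.trans (hf _) (T.symm ?_)
  refine T.trans (comp_app T _ _ _) (T.trans (dne_app T _) (T.mu ?_))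
  simp only [Term.csubstFresh, Term.msubst, Term.cwk, Term.rename, Ctx.wk, Ctx.rename,
    Term.weaken_rename, Ren.lift, Ctx.fill, Ctx.plug]
  refine T.trans (neg_neg_app_app T f _ _) (T.app (T.refl _) (T.lam ?_))
  exact T.beta _ _

/-- For a name `a : ⊥`, the body `M` equals `a M`, so this is an instance of `μa. a M = M`. -/
theorem _root_.LambdaMu.Theory.mu_bot (T : Theory S) {Γ Δ : Env S.TyConst}
    (M : Term S Γ Δ Ty.bot) : T.Eq (.mu M.cwk) M :=
  T.trans (T.mu (T.symm (T.axm (.named_bot _ _)))) (T.axm (.mu_named M))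

/-- Applied to `N` and then to `x`, the left side is `μb. N (λk. b (k x))` with `b : ⊥`. Both the
name and the `μ` disappear at type `⊥`, leaving `N (λk. k x)`, which is `N (dni x)`. -/
theorem dne_not (T : Theory S) (A : Ty S.TyConst) : T.Eq (dne A.not) (dni A).neg := by
  refine ext T (T.trans (dne_app T _) (T.trans (T.symm (T.axm (.eta _))) (T.symm ?_)))
  refine T.trans (neg_app T _ _) (T.lam (T.symm (T.trans (T.axm (.mu_app _ _)) ?_)))
  refine T.trans (T.mu ?_) (T.mu_bot _)
  simp only [Term.cwk, Term.rename, Term.weaken_rename]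
  refine T.app (T.refl _) (T.trans (T.lam ?_) (T.symm (dni_app T _)))
  exact T.axm (.named_bot _ _)

/-- The associativity law of `dne` as an algebra for the double-negation monad, whose multiplication
is `(dni A.not).neg`; both sides send `N` to `μa. N (λk. k (λx. a x))`. By `dne_not` the
multiplication is `dne` at `¬¬A`, so the law says that `dne` commutes with `dne`, which gives
`dne_focal`. -/
theorem dne_comp_neg_dni (T : Theory S) (A : Ty S.TyConst) :
    T.Eq ((dne A).comp (dni A.not).neg) ((dne A).comp (dne A).neg.neg) := by
  refine ext T (T.trans (comp_app T _ _ _) (T.symm (T.trans (comp_app T _ _ _) ?_)))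
  refine T.trans (dne_app T _) (T.trans (T.mu ?_) (T.symm (dne_app T _)))
  simp only [Term.cwk, Term.rename, Term.weaken_rename]
  refine T.trans (neg_neg_app_app T _ _ _) ?_
  refine T.symm (T.trans (T.app (neg_app T _ _) (T.refl _)) (T.trans (T.beta _ _) ?_))
  simp only [Term.subst, Term.wk_subst_single, Term.weaken_subst, Sub.single]
  refine T.app (T.refl _) (T.trans (dni_app T _) (T.lam (T.symm ?_)))
  exact T.trans (T.beta _ _) (named_dne T _ _)

end Fn

/-! ### Every `μ`-term as a value of `dne`, and focality from naturality. -/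

/-- `M[a□ := C]` and `M[a□ := D]` are equal if `C[N]` and `D[N]` are equal for every `N`. -/
theorem Term.msubst_congr (T : Theory S) {Γ Δ Δ' : Env S.TyConst} {A B : Ty S.TyConst}
    (M : Term S Γ Δ B) (r : Ren Δ (A :: Δ')) {C D : Ctx S Γ Δ' A Ty.bot}
    (h : ∀ {Γ₁ Δ₁ : Env S.TyConst} (ρ : Ren Γ Γ₁) (θ : Ren Δ' Δ₁) (N : Term S Γ₁ Δ₁ A),
      T.Eq ((C.rename ρ θ).plug N) ((D.rename ρ θ).plug N)) :
    T.Eq (M.msubst r C) (M.msubst r D) := by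
  have hr : ∀ B (x : Var Δ B), FuseRel (Ren.id (A :: Δ'))
      ((Ren.lift Ren.wk (r x) : Var (A :: A :: Δ') B)) (r x) := by
    intro _ x
    cases r x with
    | zero => exact .zero
    | succ w => exact .succ _ _ rfl
  -- No new induction is needed: replacing first `a□` by `b (id □)` and then `b□` by `C` fuses to
  -- the replacement by `C`, but equally to the replacement by `D`.
  have hC : FuseHyp T (Fn.id A) C C := ⟨fun _ _ N => Ctx.plug_congr T _ (Fn.id_app T N)⟩
  have hD : FuseHyp T (Fn.id A) C D :=
    ⟨fun ρ θ N => T.trans (Ctx.plug_congr T _ (Fn.id_app T N)) (h ρ θ N)⟩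
  exact T.trans (T.symm (Term.fuse T _ M (r := fun _ x => Ren.lift Ren.wk (r x)) (b := .zero)
    rfl hC hr))
    (Term.fuse T _ M (b := .zero) rfl hD hr)

/-- `M[a□ := b □] = M[a := b]` -/
theorem Term.msubst_named_hole (T : Theory S) {Γ Δ : Env S.TyConst} {B : Ty S.TyConst}
    (M : Term S Γ Δ B) : ∀ {A : Ty S.TyConst} {Δ' : Env S.TyConst} {r : Ren Δ (A :: Δ')}
    {b : Var Δ' A} {θ : Ren Δ Δ'}, (∀ B (x : Var Δ B), Ren.inst b (r x) = θ x) →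
    T.Eq (M.msubst r (.named b .hole)) (M.rename (Ren.id Γ) θ) := by
  have hu : ∀ {Δ Δ' : Env S.TyConst} {A B : Ty S.TyConst} {r : Ren Δ (A :: Δ')} {b : Var Δ' A}
      {θ : Ren Δ Δ'}, (∀ B (x : Var Δ B), Ren.inst b (r x) = θ x) →
      ∀ B' (x : Var (B :: Δ) B'), Ren.inst (.succ b) (r.liftUnder x) = θ.lift x := by
    intro _ _ _ _ r _ _ h _ x
    cases x with
    | zero => rfl
    | succ x =>
      simp only [Ren.liftUnder, Ren.lift, ← h]
      cases r x <;> rfl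
  induction M with
  | const c => intros; exact T.refl _
  | unit => intros; exact T.refl _
  | var x => intros; exact T.refl _
  | lam M ih => intro _ _ _ _ _ h; simp only [Term.rename, Ren.lift_id]; exact T.lam (ih h)
  | mu M ih => intro _ _ _ _ _ h; exact T.mu (ih (hu h))
  | mu₂ M ih => intro _ _ _ _ _ h; exact T.mu₂ (ih (hu (hu h)))
  | app M N ih ih' => intro _ _ _ _ _ h; exact T.app (ih h) (ih' h)
  | pair M N ih ih' => intro _ _ _ _ _ h; exact T.pair (ih h) (ih' h)
  | fst M ih => intro _ _ _ _ _ h; exact T.fst (ih h)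
  | snd M ih => intro _ _ _ _ _ h; exact T.snd (ih h)
  | named a M ih =>
    intro _ _ r b θ h
    simp only [Term.msubst, Term.rename, ← h]
    cases r a <;> exact T.named _ (ih h)
  | named₂ a₁ a₂ M ih =>
    intro _ Δ' r b θ h
    simp only [Term.msubst, Term.rename, ← h]
    cases r a₁ with
    | zero =>
      -- The clause for a pair of names leaves `b (μa. [a₁, a₂] M)`, which has to be contracted;
      -- hence the result is an equality in `T` and not of terms.
      refine T.trans (T.axm (.named_mu _ _)) ?_
      simp only [Term.rename, Term.cwk_rename_inst]
      exact T.named₂ _ _ (ih h)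
    | succ w =>
      cases r a₂ with
      | zero =>
        refine T.trans (T.axm (.named_mu _ _)) ?_
        simp only [Term.rename, Term.cwk_rename_inst]
        exact T.named₂ _ _ (ih h)
      | succ w' => exact T.named₂ _ _ (ih h)

/-- `λk. M[a□ := k □]` -/
def Term.reify {Γ Δ : Env S.TyConst} {A : Ty S.TyConst} (M : Term S Γ (A :: Δ) Ty.bot) :
    Term S Γ Δ A.not.not :=
  .lam (M.wk.csubst (.arg (.var .zero) .hole))

theorem Term.reify_cwk_app (T : Theory S) {Γ Δ : Env S.TyConst} {A B : Ty S.TyConst}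
    (M : Term S Γ (A :: Δ) Ty.bot) (N : Term S Γ (B :: Δ) A.not) :
    T.Eq (.app M.reify.cwk N) (M.csubstFresh (.arg N .hole)) := by
  -- Weakening by a fresh name changes the underlying renaming from the identity to `Ren.lift
  -- Ren.wk`, the one behind `csubstFresh`. The argument `N` may thus mention the fresh name.
  have e : M.reify.cwk (B := B) =
      .lam (M.wk.msubst (Ren.lift Ren.wk) (.arg (.var .zero) .hole)) := by
    simp only [Term.reify, Term.cwk, Term.rename, Term.csubst, Ren.lift_id]
    rw [Term.msubst_rename (θ := Ren.id _) (r' := Ren.lift Ren.wk) _ (fun _ _ => rfl),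
      Term.rename_id]
    rfl
  rw [e]
  refine T.trans (T.beta _ _) ?_
  rw [Term.wk, Term.msubst_arg_subst (σ := Sub.single N) M (N := N) (fun _ _ => rfl) rfl]
  exact T.refl _

theorem Term.dne_reify (T : Theory S) {Γ Δ : Env S.TyConst} {A : Ty S.TyConst}
    (M : Term S Γ (A :: Δ) Ty.bot) :
    T.Eq (.app ((Fn.dne A).weaken Γ Δ) M.reify) (.mu M) := by
  refine T.trans (Fn.dne_app T _) (T.mu (T.trans (M.reify_cwk_app T _) ?_))
  -- The context `(λx. b x) □` contracts to `b □`; replacing by it renames `a` to `b`, which is the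
  -- identity because `b` takes the position of `a`.
  refine T.trans (M.msubst_congr T (D := .named .zero .hole) _ fun _ _ _ => T.beta _ _) ?_
  have := M.msubst_named_hole T (r := Ren.lift Ren.wk) (b := .zero) (θ := Ren.id _)
    (fun _ x => by cases x <;> rfl)
  rwa [Term.rename_id] at this

/-- Since `μa. M` is `dne` of `M.reify`, the assumption moves `f` through `dne`; then `¬¬f` feeds
`λx. b (f x)` to `M.reify`, which is the replacement of `a□` by `b (f □)`. -/
theorem focal_of_dne_natural (T : Theory S) {A B : Ty S.TyConst} {f : Fn S A B}
    (h : T.Eq (f.comp (Fn.dne A)) ((Fn.dne B).comp f.neg.neg)) : Focal T f := by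
  intro Γ Δ M
  refine T.trans (T.app (T.refl _) (T.symm (M.dne_reify T))) ?_
  refine T.trans (T.symm (Fn.comp_app T _ _ _)) (T.trans (Fn.app_congr T h _) ?_)
  refine T.trans (Fn.comp_app T _ _ _) (T.trans (Fn.dne_app T _) (T.mu ?_))
  rw [Term.cwk, Term.rename, Term.weaken_rename]
  refine T.trans (Fn.neg_neg_app_app T f M.reify.cwk _) (T.trans (M.reify_cwk_app T _) ?_)
  refine M.msubst_congr T _ fun ρ θ N => ?_
  simp only [Ctx.rename, Ctx.plug, Term.rename, Term.wk, Term.weaken_rename]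
  refine T.trans (T.beta _ _) ?_
  simp only [Term.subst, Term.weaken_subst]
  exact T.beta _ _

theorem Fn.dne_focal (T : Theory S) (A : Ty S.TyConst) : Focal T (Fn.dne A : Fn S _ A) :=
  focal_of_dne_natural T
    (T.trans (Fn.comp_congr T (T.refl _) (Fn.dne_not T _)) (Fn.dne_comp_neg_dni T A))

end equational
-- The category of types and functions modulo the theory.
section category
open CategoryTheory
variable {S : Signature.{u, v}} {T : Theory S}

/-- The category of types and functions up to equality in a theory. -/
structure Theory.Cat (T : Theory S) where
  ty : Ty S.TyConst

def Theory.fnSetoid (T : Theory S) (B A : Ty S.TyConst) : Setoid (Fn S B A) where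
  r := T.Eq
  iseqv := ⟨T.refl, T.symm, T.trans⟩

/-- Passing to classes turns equality in `T` into genuine equality, so diagrams can be chased by
rewriting. Note that `≫` reverses the order of `Fn.comp`. -/
instance : Category.{max u v} T.Cat where
  Hom B A := Quotient (T.fnSetoid B.ty A.ty)
  id A := Quotient.mk (T.fnSetoid A.ty A.ty) (Fn.id A.ty)
  comp {A B C} f g := Quotient.map₂ (sa := T.fnSetoid A.ty B.ty) (sb := T.fnSetoid B.ty C.ty)
    (sc := T.fnSetoid A.ty C.ty) (fun f g => g.comp f)
    (fun _ _ hf _ _ hg => Fn.comp_congr T hg hf) f g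
  id_comp := by
    rintro _ _ ⟨f⟩
    exact Quotient.sound (s := T.fnSetoid _ _)
      (Fn.ext T (T.trans (Fn.comp_app T _ _ _) (T.app (T.refl _) (Fn.id_app T _))))
  comp_id := by
    rintro _ _ ⟨f⟩
    exact Quotient.sound (s := T.fnSetoid _ _)
      (Fn.ext T (T.trans (Fn.comp_app T _ _ _) (Fn.id_app T _)))
  assoc := by
    rintro _ _ _ _ ⟨f⟩ ⟨g⟩ ⟨h⟩
    refine Quotient.sound (s := T.fnSetoid _ _) (Fn.ext T (T.trans (Fn.comp_app T _ _ _) ?_))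
    refine T.trans (T.app (T.refl _) (Fn.comp_app T _ _ _)) (T.symm ?_)
    exact T.trans (Fn.comp_app T _ _ _) (Fn.comp_app T _ _ _)

/-- A function as a morphism. -/
def Theory.hom (T : Theory S) {B A : Ty S.TyConst} (f : Fn S B A) :
    (⟨B⟩ : T.Cat) ⟶ ⟨A⟩ := Quotient.mk (T.fnSetoid B A) f

theorem Theory.hom_eq_iff {B A : Ty S.TyConst} {f g : Fn S B A} :
    T.hom f = T.hom g ↔ T.Eq f g :=
  ⟨fun h => Quotient.exact (s := T.fnSetoid B A) h,
    fun h => Quotient.sound (s := T.fnSetoid B A) h⟩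

theorem Theory.hom_comp {A B C : Ty S.TyConst} (g : Fn S B C) (f : Fn S A B) :
    T.hom (g.comp f) = T.hom f ≫ T.hom g := rfl

theorem Fn.hom_neg_comp {A B C : Ty S.TyConst} (g : Fn S B C) (f : Fn S A B) :
    T.hom (g.comp f).neg = T.hom g.neg ≫ T.hom f.neg := Theory.hom_eq_iff.2 (Fn.neg_comp T g f)

theorem Fn.hom_neg_congr {A B : Ty S.TyConst} {f g : Fn S A B} (h : T.hom f = T.hom g) :
    T.hom f.neg = T.hom g.neg := Theory.hom_eq_iff.2 (Fn.neg_congr T (Theory.hom_eq_iff.1 h))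

theorem Fn.hom_dni_dne (A : Ty S.TyConst) :
    T.hom (Fn.dni A) ≫ T.hom (Fn.dne A) = 𝟙 _ := Theory.hom_eq_iff.2 (Fn.dne_dni T A)

theorem Focal.hom_dne_natural {A B : Ty S.TyConst} {f : Fn S A B} (hf : Focal T f) :
    T.hom (Fn.dne A) ≫ T.hom f = T.hom f.neg.neg ≫ T.hom (Fn.dne B) :=
  Theory.hom_eq_iff.2 (Fn.dne_natural T hf)

/-- A triangle identity: `dne` at `¬A` is `¬dni`, so the composite is the negation of `dne ∘ dni =
id`. -/
theorem Fn.hom_neg_dne_dne (A : Ty S.TyConst) :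
    T.hom (Fn.dne A).neg ≫ T.hom (Fn.dne A.not) = 𝟙 _ := by
  rw [Theory.hom_eq_iff.2 (Fn.dne_not T A), ← Fn.hom_neg_comp,
    Fn.hom_neg_congr (g := Fn.id A) (Fn.hom_dni_dne A)]
  exact Theory.hom_eq_iff.2 (Fn.neg_id T A)

theorem FocusFunctor.hom_map_comp (F : FocusFunctor T) {A B C : Ty S.TyConst}
    (g : FocalFn T B C) (f : FocalFn T A B) :
    T.hom (F.map (g.comp f)).fn = T.hom (F.map f).fn ≫ T.hom (F.map g).fn :=
  Theory.hom_eq_iff.2 (F.map_comp g f)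

theorem FocusFunctor.hom_map_congr (F : FocusFunctor T) {A B : Ty S.TyConst}
    {f g : FocalFn T A B} (h : T.hom f.fn = T.hom g.fn) :
    T.hom (F.map f).fn = T.hom (F.map g).fn :=
  Theory.hom_eq_iff.2 (F.map_congr (Theory.hom_eq_iff.1 h))

section negNatIso
variable {F : FocusFunctor T} {G : Functor T} (i : NegNatIso F G)

theorem NegNatIso.hom_hom_inv (A : Ty S.TyConst) :
    T.hom (i.hom A).fn ≫ T.hom (i.inv A).fn = 𝟙 _ := Theory.hom_eq_iff.2 (i.hom_inv A)

theorem NegNatIso.hom_inv_hom (A : Ty S.TyConst) :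
    T.hom (i.inv A).fn ≫ T.hom (i.hom A).fn = 𝟙 _ := Theory.hom_eq_iff.2 (i.inv_hom A)

theorem NegNatIso.hom_natural {A B : Ty S.TyConst} (f : Fn S B A) :
    T.hom (i.hom A).fn ≫ T.hom (F.map (FocalFn.neg T f)).fn =
      T.hom (G.map f).neg ≫ T.hom (i.hom B).fn := Theory.hom_eq_iff.2 (i.natural f)

theorem NegNatIso.inv_natural {A B : Ty S.TyConst} (f : Fn S B A) :
    T.hom (i.inv A).fn ≫ T.hom (G.map f).neg =
      T.hom (F.map (FocalFn.neg T f)).fn ≫ T.hom (i.inv B).fn := by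
  rw [← Category.comp_id (T.hom (G.map f).neg), ← i.hom_hom_inv, ← reassoc_of% i.hom_natural,
    reassoc_of% i.hom_inv_hom]

end negNatIso

/-! ### Transposition between algebras and coalgebras, and focal initiality. -/

/-- `dne` as a focal function. -/
def FocalFn.dne (T : Theory S) (A : Ty S.TyConst) : FocalFn T A.not.not A :=
  ⟨Fn.dne A, Fn.dne_focal T A⟩

/-- The transpose `dne ∘ ¬f : ¬A → C` of `f : ¬C → A`. -/
def FocalFn.transpose {A C : Ty S.TyConst} (f : Fn S C.not A) : FocalFn T A.not C :=
  ⟨(Fn.dne C).comp f.neg, focal_comp T (Fn.dne_focal T C) (focal_neg T f)⟩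

/-- The double transpose is `dne ∘ ¬¬f ∘ ¬dne`; focality pulls `f` out in front of `dne ∘ ¬dne`,
which is the identity. -/
theorem FocalFn.hom_transpose_transpose {A C : Ty S.TyConst} {f : Fn S C.not A}
    (hf : Focal T f) :
    T.hom (FocalFn.transpose (T := T) (FocalFn.transpose (T := T) f).fn).fn = T.hom f := by
  simp only [FocalFn.transpose, Theory.hom_comp, Fn.hom_neg_comp, Category.assoc]
  rw [← hf.hom_dne_natural, reassoc_of% Fn.hom_neg_dne_dne]

theorem FocalFn.hom_transpose_congr {A C : Ty S.TyConst} {f g : Fn S C.not A}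
    (h : T.hom f = T.hom g) : T.hom (FocalFn.transpose (T := T) f).fn =
      T.hom (FocalFn.transpose (T := T) g).fn := by
  simp only [FocalFn.transpose, Theory.hom_comp, Fn.hom_neg_congr h]

/-- The `G`-coalgebra on `¬A` that corresponds to an `F`-algebra on `A`. -/
def NegNatIso.coalgebra {F : FocusFunctor T} {G : Functor T} (i : NegNatIso F G)
    {A : Ty S.TyConst} (f : FocalFn T (F.obj A) A) : FocalFn T A.not (G.obj A.not) :=
  FocalFn.transpose (f.comp ((F.map (FocalFn.dne T A)).comp (i.hom A.not))).fn

theorem NegNatIso.isFocallyInitialAlgebra {F : FocusFunctor T} {G : Functor T}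
    (i : NegNatIso F G) {C : Ty S.TyConst} {X : Fn S C (G.obj C)} (hX : IsFinalCoalgebra G X)
    (fX : Focal T X) : IsFocallyInitialAlgebra F (C := C.not) (X.neg.comp (i.inv C).fn) := by
  refine ⟨focal_comp T (focal_neg T X) (i.inv C).focal, fun {A} f => ?_⟩
  obtain ⟨h, hh, hu⟩ := hX (i.coalgebra f).fn
  have hmap : ∀ k : Fn S A.not C, T.hom (F.map (FocalFn.transpose (T := T) k)).fn =
      T.hom (F.map (FocalFn.neg T k)).fn ≫ T.hom (F.map (FocalFn.dne T A)).fn :=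
    fun k => F.hom_map_comp (FocalFn.dne T A) (FocalFn.neg T k)
  -- Finality does not say that `h` is focal, but its transpose always is.
  refine ⟨FocalFn.transpose h, ?_, fun k hk => ?_⟩
  · rw [← Theory.hom_eq_iff]
    have hn := Fn.hom_neg_congr (Theory.hom_eq_iff.2 hh)
    rw [Fn.hom_neg_comp, Fn.hom_neg_comp] at hn
    have ht := FocalFn.hom_transpose_transpose
      (f.comp ((F.map (FocalFn.dne T A)).comp (i.hom A.not))).focal
    change T.hom (i.coalgebra f).fn.neg ≫ T.hom (Fn.dne A) = (T.hom (i.hom A.not).fn ≫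
      T.hom (F.map (FocalFn.dne T A)).fn) ≫ T.hom f.fn at ht
    rw [Theory.hom_comp, Theory.hom_comp, Theory.hom_comp, hmap]
    change (_ ≫ _) ≫ T.hom h.neg ≫ T.hom (Fn.dne A) = _
    -- The negated coalgebra square exchanges `¬X` for `¬(Gh)`, the double transpose restores the
    -- algebra side, and naturality brings `φ⁻¹` next to `φ`, where they cancel.
    rw [Category.assoc, reassoc_of% hn, ht, reassoc_of% i.inv_natural, Category.assoc,
      Category.assoc, reassoc_of% i.hom_inv_hom]
  · have hk := Theory.hom_eq_iff.2 hk
    -- As `k` is the transpose of `l`, it suffices that `l` is a coalgebra morphism, hence equal to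
    -- `h`.
    let l := FocalFn.transpose (T := T) k.fn
    have lk : T.hom (FocalFn.transpose (T := T) l.fn).fn = T.hom k.fn :=
      FocalFn.hom_transpose_transpose k.focal
    refine Theory.hom_eq_iff.1 (lk.symm.trans (FocalFn.hom_transpose_congr ?_))
    refine Theory.hom_eq_iff.2 (hu _ (Theory.hom_eq_iff.1 ?_))
    let p := f.comp ((F.map (FocalFn.dne T A)).comp (i.hom A.not))
    -- The algebra square with `φ` moved to the other side: `Fk` factors as `F(dne) ∘ F(¬l)`, so
    -- naturality of `φ` at `l` applies.
    have e : T.hom (k.fn.comp X.neg) = T.hom (p.fn.comp (G.map l.fn).neg) := by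
      have hFk := (F.hom_map_congr lk).symm.trans (hmap l.fn)
      rw [Theory.hom_comp, Theory.hom_comp, Theory.hom_comp, Category.assoc, hFk] at hk
      have := congrArg (T.hom (i.hom C).fn ≫ ·) hk
      simp only [reassoc_of% i.hom_hom_inv, Category.assoc, reassoc_of% i.hom_natural] at this
      have hp : T.hom p.fn = T.hom (i.hom A.not).fn ≫ T.hom (F.map (FocalFn.dne T A)).fn ≫
          T.hom f.fn := by
        change T.hom (f.fn.comp ((F.map (FocalFn.dne T A)).fn.comp (i.hom A.not).fn)) = _
        rw [Theory.hom_comp, Theory.hom_comp, Category.assoc]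
      rw [Theory.hom_comp, this, Theory.hom_comp, hp]
    have e := Fn.hom_neg_congr e
    rw [Fn.hom_neg_comp, Fn.hom_neg_comp] at e
    have fGl : Focal T (G.map l.fn) := G.map_focal l.focal
    change (T.hom k.fn.neg ≫ T.hom (Fn.dne C)) ≫ T.hom X =
      (T.hom p.fn.neg ≫ T.hom (Fn.dne _)) ≫ T.hom (G.map l.fn)
    -- Focality of `X` and of `G l` lets both pass through `dne` as double negations, after which
    -- the negation of the square above closes the goal.
    rw [Category.assoc, Category.assoc, fX.hom_dne_natural, reassoc_of% e, fGl.hom_dne_natural]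

end category
end LambdaMu

theorem theorem1 {S : LambdaMu.Signature.{u, v}} (T : LambdaMu.Theory S)
    (F : LambdaMu.FocusFunctor T) (G : LambdaMu.Functor T) (i : LambdaMu.NegNatIso F G)
    (νG : LambdaMu.Ty S.TyConst) (X : LambdaMu.Fn S νG (G.obj νG))
    (hfinal : LambdaMu.IsFinalCoalgebra G X) (hfocal : LambdaMu.Focal T X) :
    LambdaMu.IsFocallyInitialAlgebra F (C := νG.not) (X.neg.comp (i.inv νG).fn) :=
  i.isFocallyInitialAlgebra hfinal hfocal
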